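/- **Theorem.** Let $M(2)=\mathbb C\rtimes SO(2)$ be the Euclidean motion group, with elements $(z,e^{i\varphi})$, group law $(z,e^{i\varphi})(w,e^{i\psi})=(z+e^{i\varphi}w,e^{i(\varphi+\psi)})$ and Haar measure $d\nu=dz\,d\varphi$. For $a>0$ let $\pi_a$ be the unitary representation of $M(2)$ on $L^2(S^1)$ given by $$\pi_a(z,e^{i\varphi})g(\theta)=e^{i\,\mathrm{Re}(a e^{-i\theta}z)}\,g(\theta-\varphi),$$ let $\hat f(a)=\int_{M(2)}f(x)\pi_a(x)\,d\nu(x)$ for $f\in L^1(M(2))$, let $d\mu(a)=a\,da$ on $(0,\infty)$, and let $\|T\|_{S_p}=(\mathrm{tr}\,(T^*T)^{p/2})^{1/p}$ be the Schatten norm. For $\beta<1$ let $f_\beta(z,e^{i\varphi})=\chi_{B_1(0)}(z)\,|z|^{-\beta}$. 1. For every $\beta<1$ the function $f_\beta$ is square integrable and compactly supported. 2. For every $1<q<2$ there is $\beta\in(\tfrac23,1)$ such that $$\int_0^\infty\|\hat f_\beta(a)\|_{S_q}^q\,a\,da=\infty .$$ 3. Let $2<p<\infty$. For $1\le r<\infty$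 let $L^r(M(2)\times(0,\infty),S_r,d\nu\otimes d\mu)$ be the space of measurable fields of operators $\varsigma(x,a)$ on $L^2(S^1)$ with $\|\varsigma\|_r^r=\int\!\!\int\|\varsigma(x,a)\|_{S_r}^r\,d\mu(a)\,d\nu(x)<\infty$. For $f,g\in L^2(M(2))$ put $V(f,g)(x,a)=\int_{M(2)}f(x')g(x'^{-1}x)\pi_a(x')\,d\nu(x')$ and $$\langle V(f,g),\varsigma\rangle=\int_{M(2)}\int_0^\infty\mathrm{tr}\big(\varsigma^*(x,a)V(f,g)(x,a)\big)\,d\mu(a)\,d\nu(x).$$ The Weyl transform $W_\varsigma$ is the operator on $L^2(M(2))$ given by $\langle W_\varsigma f,\bar g\rangle=\langle V(f,g),\varsigma\rangle$. Then the Weyl transform is unbounded for symbols in $L^p$: (a) there is no constant $C$ such that $|\langle V(f,g),\varsigma\rangle|\le C\|\varsigma\|_p\|f\|_2\|g\|_2$ for all $\varsigma\in L^2\cap L^p$ and all $f,g\in L^2(M(2))$; that is, $\varsigma\mapsto W_\varsigma$ does not extend from $L^2\cap L^p$ to a bounded map from $L^p$ to the bounded operators on $L^2(M(2))$; (b) there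 is a symbol $\varsigma\in L^p$ for which $W_\varsigma$ is not a bounded operator: no bounded operator $W$ on $L^2(M(2))$ satisfies $\langle Wf,\bar g\rangle=\langle V(f,g),\varsigma\rangle$ for all those $f,g\in L^2(M(2))$ for which the pairing converges absolutely (that is, $\varsigma^*(x,a)V(f,g)(x,a)$ is of trace class for almost all $(x,a)$ and its trace is integrable). -/

import Mathlib

open MeasureTheory Set
open scoped ENNReal

noncomputable section

namespace EuclideanMotion

/-! ### The group `M(2)` -/

instance factTwoPi : Fact (0 < 2 * Real.pi) := ⟨Real.two_pi_pos⟩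

/-- The circle `S¹`, parametrised by the angle `θ ∈ ℝ / 2πℤ`. -/
abbrev S1 : Type := AddCircle (2 * Real.pi)

/-- The point `e^{iθ}` of the unit circle in `ℂ`. -/
def ei (θ : S1) : ℂ := (AddCircle.toCircle θ : ℂ)

theorem ei_coe (t : ℝ) : ei (t : S1) = Complex.exp (t * Complex.I) := by
  have h : 2 * Real.pi / (2 * Real.pi) * t = t := by
    rw [div_self Real.two_pi_pos.ne', one_mul]
  rw [ei, AddCircle.toCircle_apply_mk, h, Circle.coe_exp]

theorem ei_zero : ei 0 = 1 := by simp [ei]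

theorem ei_add (θ φ : S1) : ei (θ + φ) = ei θ * ei φ := by
  simp [ei, AddCircle.toCircle_add]

theorem continuous_ei : Continuous ei :=
  continuous_subtype_val.comp AddCircle.continuous_toCircle

theorem ei_neg_mul (θ : S1) : ei (-θ) * ei θ = 1 := by
  rw [← ei_add, neg_add_cancel, ei_zero]

/-- The Euclidean motion group `M(2) = ℂ ⋊ SO(2)`: the pair `(z, φ)` stands for `(z, e^{iφ})`. -/
abbrev M2 : Type := ℂ × S1

/-- The Haar measure `dν = dz dφ` of `M(2)`: Lebesgue measure on `ℂ` times the arc length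
measure, of total mass `2π`, on `S¹`. -/
abbrev haar : Measure M2 := (volume : Measure ℂ).prod (volume : Measure S1)

/-- The group law `(z, e^{iφ}) (w, e^{iψ}) = (z + e^{iφ} w, e^{i(φ + ψ)})`. -/
instance : Mul M2 := ⟨fun x y => (x.1 + ei x.2 * y.1, x.2 + y.2)⟩

instance : One M2 := ⟨((0 : ℂ), (0 : S1))⟩

instance : Inv M2 := ⟨fun x => (-(ei (-x.2) * x.1), -x.2)⟩

theorem m2_mul_def (x y : M2) : x * y = (x.1 + ei x.2 * y.1, x.2 + y.2) := rfl

theorem m2_one_def : (1 : M2) = ((0 : ℂ), (0 : S1)) := rfl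

theorem m2_inv_def (x : M2) : x⁻¹ = (-(ei (-x.2) * x.1), -x.2) := rfl

instance : Group M2 :=
  Group.ofLeftAxioms
    (fun x y z => by
      simp only [m2_mul_def, ei_add]
      exact Prod.ext (by simp only []; ring) (add_assoc _ _ _))
    (fun x => by
      simp only [m2_mul_def, m2_one_def, ei_zero]
      exact Prod.ext (by simp) (zero_add _))
    (fun x => by
      simp only [m2_mul_def, m2_one_def, m2_inv_def]
      exact Prod.ext (by simp) (neg_add_cancel _))

/-! ### The representations `π_a` -/

/-- The Hilbert space `L²(S¹)`, with inner product `(1 / 2π) ∫ conj (g θ) * h θ dθ`. -/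
abbrev H : Type := Lp ℂ 2 (AddCircle.haarAddCircle : Measure S1)

/-- Multiplication by a continuous function, as an operator on `L²(S¹)`. -/
def mulOp : C(S1, ℂ) →L[ℂ] H →L[ℂ] H :=
  ((ContinuousLinearMap.lsmul ℂ ℂ).holderL AddCircle.haarAddCircle ∞ 2 2).comp
    (ContinuousMap.toLp ∞ AddCircle.haarAddCircle ℂ)

theorem mulOp_coeFn (u : C(S1, ℂ)) (g : H) :
    mulOp u g =ᵐ[AddCircle.haarAddCircle] fun θ => u θ * g θ := by
  have h1 := ContinuousLinearMap.coeFn_holder (r := 2) (ContinuousLinearMap.lsmul ℂ ℂ)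
    (ContinuousMap.toLp ∞ AddCircle.haarAddCircle ℂ u) g
  have h2 := ContinuousMap.coeFn_toLp (p := ∞) (𝕜 := ℂ)
    (AddCircle.haarAddCircle : Measure S1) u
  filter_upwards [h1, h2] with θ h1 h2
  rw [h2] at h1
  exact h1

theorem measurePreserving_sub (φ : S1) :
    MeasurePreserving (fun θ : S1 => θ - φ) AddCircle.haarAddCircle AddCircle.haarAddCircle :=
  measurePreserving_sub_right _ φ

/-- Rotation `g ↦ g (· - φ)`, as an operator on `L²(S¹)`. -/
def rotOp (φ : S1) : H →L[ℂ] H :=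
  (Lp.compMeasurePreservingₗᵢ ℂ (fun θ : S1 => θ - φ)
    (measurePreserving_sub φ)).toContinuousLinearMap

theorem rotOp_coeFn (φ : S1) (g : H) :
    rotOp φ g =ᵐ[AddCircle.haarAddCircle] fun θ => g (θ - φ) :=
  Lp.coeFn_compMeasurePreserving g (measurePreserving_sub φ)

/-- The function `θ ↦ e^{i Re (a e^{-iθ} z)}`. -/
def phase (a : ℝ) (z : ℂ) : C(S1, ℂ) where
  toFun θ := Complex.exp (Complex.I * ((a * ei (-θ) * z).re : ℝ))
  continuous_toFun := by
    have := continuous_ei.comp (continuous_neg (G := S1))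
    simp only [Function.comp_def] at this
    fun_prop

theorem phase_add (a : ℝ) (z w : ℂ) (θ : S1) : phase a (z + w) θ = phase a z θ * phase a w θ := by
  simp only [phase, ContinuousMap.coe_mk, ← Complex.exp_add, mul_add, Complex.add_re,
    Complex.ofReal_add]

theorem norm_phase (a : ℝ) (z : ℂ) (θ : S1) : ‖phase a z θ‖ = 1 := by
  simp only [phase, ContinuousMap.coe_mk]
  rw [mul_comm, Complex.norm_exp_ofReal_mul_I]

/-- The representation `π_a` of `M(2)` on `L²(S¹)`:
`(π_a (z, e^{iφ}) g) θ = e^{i Re (a e^{-iθ} z)} g (θ - φ)`. -/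
def rep (a : ℝ) : M2 →* (H →L[ℂ] H) where
  toFun x := (mulOp (phase a x.1)).comp (rotOp x.2)
  map_one' := by
    ext1 g
    apply Lp.ext
    have h1 := mulOp_coeFn (phase a (1 : M2).1) (rotOp (1 : M2).2 g)
    have h2 := rotOp_coeFn (1 : M2).2 g
    filter_upwards [h1, h2] with θ h1 h2
    have h0 : phase a (1 : M2).1 θ = 1 := by simp [phase, m2_one_def]
    simp only [ContinuousLinearMap.comp_apply, one_apply_eq_self]
    rw [h1, h2, h0, one_mul, m2_one_def, sub_zero]
  map_mul' x y := by
    ext1 g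
    apply Lp.ext
    have h1 := mulOp_coeFn (phase a (x * y).1) (rotOp (x * y).2 g)
    have h2 := rotOp_coeFn (x * y).2 g
    have h3 := mulOp_coeFn (phase a x.1) (rotOp x.2 (mulOp (phase a y.1) (rotOp y.2 g)))
    have h4 := rotOp_coeFn x.2 (mulOp (phase a y.1) (rotOp y.2 g))
    have h5 := (measurePreserving_sub x.2).quasiMeasurePreserving.ae_eq_comp
      (mulOp_coeFn (phase a y.1) (rotOp y.2 g))
    have h6 := (measurePreserving_sub x.2).quasiMeasurePreserving.ae_eq_comp
      (rotOp_coeFn y.2 g)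
    filter_upwards [h1, h2, h3, h4, h5, h6] with θ h1 h2 h3 h4 h5 h6
    simp only [Function.comp_apply] at h5 h6
    simp only [ContinuousLinearMap.comp_apply, mul_apply_eq_comp]
    rw [h1, h2, h3, h4, h5, h6]
    have hp : phase a (ei x.2 * y.1) θ = phase a y.1 (θ - x.2) := by
      have : -(θ - x.2) = -θ + x.2 := by abel
      simp only [phase, ContinuousMap.coe_mk, this, ei_add]
      ring_nf
    have hs : θ - (x.2 + y.2) = θ - x.2 - y.2 := by abel
    simp only [m2_mul_def, phase_add, hp, hs]
    ring

theorem rep_coeFn (a : ℝ) (z : ℂ) (φ : S1) (g : H) :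
    rep a ((z, φ) : M2) g =ᵐ[AddCircle.haarAddCircle] fun θ =>
      Complex.exp (Complex.I * ((a * ei (-θ) * z).re : ℝ)) * g (θ - φ) := by
  filter_upwards [mulOp_coeFn (phase a z) (rotOp φ g), rotOp_coeFn φ g] with θ h1 h2
  rw [h2] at h1
  exact h1

theorem norm_rep (a : ℝ) (x : M2) (g : H) : ‖rep a x g‖ = ‖g‖ := by
  have h : ‖rep a x g‖ = ‖rotOp x.2 g‖ := by
    apply le_antisymm
    · apply Lp.norm_le_norm_of_ae_le
      filter_upwards [mulOp_coeFn (phase a x.1) (rotOp x.2 g)] with θ h1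
      exact le_of_eq (by
        change ‖mulOp (phase a x.1) (rotOp x.2 g) θ‖ = _
        rw [h1, norm_mul, norm_phase, one_mul])
    · apply Lp.norm_le_norm_of_ae_le
      filter_upwards [mulOp_coeFn (phase a x.1) (rotOp x.2 g)] with θ h1
      exact le_of_eq (by
        change _ = ‖mulOp (phase a x.1) (rotOp x.2 g) θ‖
        rw [h1, norm_mul, norm_phase, one_mul])
  rw [h]
  exact (Lp.compMeasurePreservingₗᵢ ℂ (fun θ : S1 => θ - x.2) (measurePreserving_sub x.2)).norm_map g

theorem continuous_rep (a : ℝ) (g : H) : Continuous fun x : M2 => rep a x g := by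
  have h1 : Continuous fun z : ℂ => phase a z := by
    apply ContinuousMap.continuous_of_continuous_uncurry
    have := continuous_ei.comp (continuous_neg (G := S1))
    simp only [Function.comp_def] at this
    have h3 : Continuous fun y : ℂ × S1 => ei (-y.2) := this.comp continuous_snd
    simp only [Function.uncurry_def, phase, ContinuousMap.coe_mk]
    fun_prop
  have h2 : Continuous fun φ : S1 => rotOp φ g := by
    let F : S1 → C(S1, S1) := fun φ => ⟨fun θ => θ - φ, by fun_prop⟩
    have hF : Continuous F := by
      apply ContinuousMap.continuous_of_continuous_uncurry
      simp only [Function.uncurry_def, F, ContinuousMap.coe_mk]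
      fun_prop
    exact Continuous.compMeasurePreservingLp (continuous_const (y := g)) hF
      measurePreserving_sub (by simp)
  have h3 : Continuous fun x : ℂ × S1 => mulOp (phase a x.1) (rotOp x.2 g) :=
    (mulOp.continuous.comp (h1.comp continuous_fst)).clm_apply (h2.comp continuous_snd)
  exact h3

/-! ### The group Fourier transform -/

theorem integrable_smul_rep {f : M2 → ℂ} (hf : Integrable f haar) (a : ℝ) (g : H) :
    Integrable (fun x => f x • rep a x g) haar := by
  refine Integrable.mono' (hf.norm.mul_const ‖g‖)
    (hf.aestronglyMeasurable.smul (continuous_rep a g).aestronglyMeasurable) ?_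
  exact Filter.Eventually.of_forall fun x => by rw [norm_smul, norm_rep]

open Classical in
/-- The group Fourier transform `π_a(f) = ∫ f(x) π_a(x) dν(x)` of `f ∈ L¹(M(2))`, a bounded
operator on `L²(S¹)`; the integral is taken in the strong sense. (It is `0` if `f ∉ L¹`.) -/
def groupFourier (f : M2 → ℂ) (a : ℝ) : H →L[ℂ] H :=
  if hf : Integrable f haar then
    LinearMap.mkContinuous
      { toFun := fun g => ∫ x, f x • rep a x g ∂haar
        map_add' := fun g h => by
          simp only [map_add, smul_add]
          exact integral_add (integrable_smul_rep hf a g) (integrable_smul_rep hf a h)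
        map_smul' := fun c g => by
          simp only [map_smul, RingHom.id_apply, smul_comm _ c]
          exact integral_smul c _ }
      (∫ x, ‖f x‖ ∂haar)
      (fun g => by
        refine (norm_integral_le_integral_norm _).trans (le_of_eq ?_)
        simp only [norm_smul, norm_rep]
        exact integral_mul_const _ _)
  else 0

theorem groupFourier_apply {f : M2 → ℂ} (hf : Integrable f haar) (a : ℝ) (g : H) :
    groupFourier f a g = ∫ x, f x • rep a x g ∂haar := by
  rw [groupFourier, dif_pos hf]
  rfl

/-- The Plancherel measure `dμ(a) = a da` on `(0, ∞)`. -/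
def plancherel : Measure ℝ :=
  (volume.restrict (Ioi 0)).withDensity fun a => ENNReal.ofReal a

/-! ### Trace and Schatten norms -/

/-- The trace of a trace class operator, computed in the orthonormal basis `b` (on which it does
not depend). -/
def opTrace {E ι : Type*} [NormedAddCommGroup E] [InnerProductSpace ℂ E]
    (b : HilbertBasis ι ℂ E) (T : E →L[ℂ] E) : ℂ :=
  ∑' n, inner ℂ (b n) (T (b n))

/-- The Schatten norm `‖T‖_{S_p} = (tr (T* T)^{p/2})^{1/p}`, for `1 ≤ p < ∞`, as an element of
`[0, ∞]`; it is finite exactly if `T` belongs to `S_p`. The trace of the positive operator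
`(T* T)^{p/2}` is computed in the orthonormal basis `b` (on which it does not depend). -/
def schattenNorm {E ι : Type*} [NormedAddCommGroup E] [InnerProductSpace ℂ E] [CompleteSpace E]
    (b : HilbertBasis ι ℂ E) (p : ℝ) (T : E →L[ℂ] E) : ℝ≥0∞ :=
  (∑' n, ENNReal.ofReal (inner ℂ (b n)
    (CFC.rpow (ContinuousLinearMap.adjoint T * T) (p / 2) (b n))).re) ^ (1 / p)

/-- The orthonormal basis `θ ↦ e^{inθ}`, `n ∈ ℤ`, of `L²(S¹)`. -/
def basisH : HilbertBasis ℤ ℂ H := fourierBasis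

/-! ### Symbols, Wigner transform and Weyl transform -/

/-- `‖ς‖_p = (∫∫ ‖ς(x, a)‖_{S_p}^p dμ(a) dν(x))^{1/p}`. -/
def symbolNorm (p : ℝ) (ς : M2 → ℝ → H →L[ℂ] H) : ℝ≥0∞ :=
  (∫⁻ y : M2 × ℝ, schattenNorm basisH p (ς y.1 y.2) ^ p ∂(haar.prod plancherel)) ^ (1 / p)

/-- Membership of a symbol in `L^p(M(2) × (0, ∞), S_p, dν ⊗ dμ)`: it is a measurable field of
operators with `‖ς‖_p < ∞`. -/
def MemSymbol (p : ℝ) (ς : M2 → ℝ → H →L[ℂ] H) : Prop :=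
  (∀ u v : H, AEStronglyMeasurable (fun y : M2 × ℝ => inner ℂ u (ς y.1 y.2 v))
    (haar.prod plancherel)) ∧ symbolNorm p ς < ∞

/-- The Wigner transform `V(f, g)(x, a) = ∫ f(x') g(x'⁻¹ x) π_a(x') dν(x')`. -/
def wigner (f g : M2 → ℂ) (x : M2) (a : ℝ) : H →L[ℂ] H :=
  groupFourier (fun x' => f x' * g (x'⁻¹ * x)) a

/-- The integrand `tr (ς*(x, a) V(f, g)(x, a))` of the pairing `⟨V(f, g), ς⟩`. -/
def pairingIntegrand (ς : M2 → ℝ → H →L[ℂ] H) (f g : M2 → ℂ) (y : M2 × ℝ) : ℂ :=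
  opTrace basisH (ContinuousLinearMap.adjoint (ς y.1 y.2) * wigner f g y.1 y.2)

/-- The pairing `⟨V(f, g), ς⟩` converges absolutely: the operators `ς*(x, a) V(f, g)(x, a)` are
of trace class for almost all `(x, a)`, and their trace is integrable. -/
def PairingConverges (ς : M2 → ℝ → H →L[ℂ] H) (f g : M2 → ℂ) : Prop :=
  (∀ᵐ y ∂(haar.prod plancherel),
    schattenNorm basisH 1 (ContinuousLinearMap.adjoint (ς y.1 y.2) * wigner f g y.1 y.2) < ∞) ∧
  Integrable (pairingIntegrand ς f g) (haar.prod plancherel)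

/-- The pairing `⟨V(f, g), ς⟩ = ∫∫ tr (ς*(x, a) V(f, g)(x, a)) dμ(a) dν(x)`. -/
def pairing (ς : M2 → ℝ → H →L[ℂ] H) (f g : M2 → ℂ) : ℂ :=
  ∫ y, pairingIntegrand ς f g y ∂(haar.prod plancherel)

/-- `W` is the Weyl transform with symbol `ς`, as a bounded operator on `L²(M(2))`:
`⟨W f, ḡ⟩ = ⟨V(f, g), ς⟩` for all `f, g ∈ L²(M(2))` for which the right hand side converges
absolutely (for a symbol in `L^p`, `1 ≤ p ≤ 2`, these are all `f` and `g`). -/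
def IsWeylTransform (ς : M2 → ℝ → H →L[ℂ] H)
    (W : Lp ℂ 2 haar →L[ℂ] Lp ℂ 2 haar) : Prop :=
  ∀ f g : Lp ℂ 2 haar, PairingConverges ς f g →
    ∫ x, W f x * g x ∂haar = pairing ς f g

/-! ### The function `f_β` -/

/-- `f_β(z, e^{iφ}) = χ_{B_1(0)}(z) |z|^{-β}`. -/
def fBeta (β : ℝ) (x : M2) : ℂ :=
  (Metric.ball (0 : ℂ) 1).indicator (fun z => ((‖z‖ ^ (-β) : ℝ) : ℂ)) x.1

end EuclideanMotion

end

open EuclideanMotion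

noncomputable section

namespace EuclideanMotion

open InnerProductSpace (rankOne)
open scoped NNReal

/-! ### Schatten norms and traces of operators of rank one -/

/-! Everything is reduced to radial analysis on the plane. If `f` depends only on the translation
part, its group Fourier transform at `a` has rank one (`groupFourier_comp_fst`), so all its Schatten
norms agree and dominate the matrix coefficient `radialFourier f a`, that is `2π ∫ f(z) J₀(a|z|)
dz`.

This coefficient is tested against Gaussians. By the Gaussian Fourier integral and Fubini, pairing
it with `e^{-r²a²}` in `a da` gives `(π/r²) ∫ f(z) e^{-|z|²/(4r²)} dz`, which is at least `c·m` with
`c` independent of `r` if `f ≥ 0` and `f ≥ m` on the disc of radius `r` (`le_gaussPair`). On the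
other side `e^{-r²a²} ≤ r^{-s} (1+a²)^{-s/2}` (`gaussian_le_japanese`), and `(1+a²)^{-s/2}` lies in
`L^p(a da)` once `sp > 2`. For `p > 2` such an `s` exists below `1`, and this gap drives all the
negative statements.

For `f_β` take `m = r^{-β}` with `s < β < 1`: if the `S_q` integral were finite, Hölder would give
`c r^{-β} ≤ C r^{-s}` for small `r`. For the Weyl transform, `f_β` is replaced by bumps of height
`1/r` on discs of radius `r`, bounded in `L²`. Against the indicator of `|z| < 2` the Wigner
transform is the Fourier transform of the bump wherever `|x| < 1` (`wigner_eq_groupFourier`), so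
rank one symbols `χ(z) h(a) P` reproduce the radial pairing. A Gaussian `h` at scale `r` forces `c
r^{-1} ≤ C r^{-s}`, which refutes the bound. The single symbol with `h = ∑ 2^{-kγ} e^{-4^{-k}a²}`,
`s < γ < 1`, handles all scales at once: positivity isolates the term at the scale of the bump, of
size at least `c r^{γ-1}`. -/

theorem rpow_smul_idempotent {E : Type*} [NormedAddCommGroup E] [InnerProductSpace ℂ E]
    [CompleteSpace E] {P : E →L[ℂ] E} (hP : IsIdempotentElem P) (hP' : 0 ≤ P) {s : ℝ}
    (hs : 0 < s) (t : ℝ≥0) : CFC.rpow (t • P) s = (t ^ s : ℝ≥0) • P := by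
  have h0 : 0 ≤ t • P := smul_nonneg t.2 hP'
  have hspec : spectrum ℝ≥0 (t • P) ⊆ {0, t} := by
    intro x hx
    have h1 : (x : ℝ) ∈ spectrum ℝ ((t : ℝ) • P) := by
      have := (spectrum.algebraMap_mem_iff (R := ℝ≥0) ℝ (a := t • P) (r := x)).2 hx
      exact this
    by_cases ht : t = 0
    · subst ht
      by_cases hE : Nontrivial (E →L[ℂ] E)
      · simp only [NNReal.coe_zero, zero_smul, spectrum.zero_eq, mem_singleton_iff] at h1
        left; exact_mod_cast h1
      · rw [not_nontrivial_iff_subsingleton] at hE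
        simp at h1
    · have ht' : (t : ℝ) ≠ 0 := by exact_mod_cast ht
      have h2 := spectrum.unit_smul_eq_smul P (Units.mk0 (t : ℝ) ht')
      rw [Units.smul_def, Units.val_mk0] at h2
      rw [h2] at h1
      obtain ⟨y, hy, hyx⟩ := h1
      have hyx' : (t : ℝ) * y = x := hyx
      rcases hP.spectrum_subset ℝ hy with h | h
      · left; rw [h, mul_zero] at hyx'; exact_mod_cast hyx'.symm
      · right
        rw [mem_singleton_iff] at h ⊢
        rw [h, mul_one] at hyx'; exact_mod_cast hyx'.symm
  by_cases ht : t = 0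
  · subst ht
    have : CFC.rpow (0 : E →L[ℂ] E) s = 0 := CFC.zero_rpow (A := E →L[ℂ] E) hs.ne'
    rw [zero_smul, this, NNReal.zero_rpow hs.ne', zero_smul]
  -- On the spectrum, contained in `{0, t}`, the power function agrees with a linear one; `s > 0`
  -- makes both vanish at `0`.
  have h1 : CFC.rpow (t • P) s = cfc (fun x : ℝ≥0 => (t ^ s / t) * x) (t • P) := by
    apply cfc_congr
    intro x hx
    rcases hspec hx with h | h
    · simp [h, hs.ne']
    · rw [mem_singleton_iff] at h
      simp only [h]
      field_simp
  rw [h1, cfc_const_mul_id _ _ h0, smul_smul]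
  congr 1
  field_simp

theorem opTrace_rankOne {E ι : Type*} [NormedAddCommGroup E] [InnerProductSpace ℂ E]
    (b : HilbertBasis ι ℂ E) (v w : E) : opTrace b (rankOne ℂ v w) = inner ℂ w v := by
  rw [opTrace, ← b.tsum_inner_mul_inner]
  refine tsum_congr fun n => ?_
  rw [InnerProductSpace.rankOne_apply, inner_smul_right]

/-- `T* T` is `‖v‖²` times the projection onto `e`, so `‖v‖` is the only possibly nonzero singular
value and the exponent plays no role. -/
theorem schattenNorm_rankOne {E ι : Type*} [NormedAddCommGroup E] [InnerProductSpace ℂ E]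
    [CompleteSpace E] (b : HilbertBasis ι ℂ E) {p : ℝ} (hp : 0 < p) (v : E) {e : E}
    (he : ‖e‖ = 1) : schattenNorm b p (rankOne ℂ v e) = ENNReal.ofReal ‖v‖ := by
  have hT : ContinuousLinearMap.adjoint (rankOne ℂ v e) * rankOne ℂ v e
      = (‖v‖₊ ^ 2) • rankOne ℂ e e := by
    ext x
    simp only [InnerProductSpace.adjoint_rankOne, mul_apply_eq_comp,
      InnerProductSpace.rankOne_apply, inner_smul_right, inner_self_eq_norm_sq_to_K,
      smul_apply, NNReal.smul_def, NNReal.coe_pow, coe_nnnorm]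
    rw [← smul_assoc]
    congr 1
    simp [mul_comm]
  have hpos : (0 : E →L[ℂ] E) ≤ rankOne ℂ e e :=
    (ContinuousLinearMap.nonneg_iff_isPositive _).2 (InnerProductSpace.isPositive_rankOne_self e)
  rw [schattenNorm, hT, rpow_smul_idempotent
    (InnerProductSpace.isIdempotentElem_rankOne_self he) hpos (half_pos hp)]
  have hpow : ((‖v‖₊ ^ 2) ^ (p / 2) : ℝ≥0) = ‖v‖₊ ^ p := by
    rw [← NNReal.rpow_natCast, ← NNReal.rpow_mul]
    congr 1
    push_cast
    ring
  have hterm : ∀ n, (inner ℂ (b n) (((‖v‖₊ ^ p : ℝ≥0) • rankOne ℂ e e) (b n))).re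
      = ‖v‖ ^ p * (inner ℂ e (b n) * inner ℂ (b n) e).re := by
    intro n
    simp only [smul_apply, NNReal.smul_def, InnerProductSpace.rankOne_apply,
      NNReal.coe_rpow, coe_nnnorm]
    rw [← Complex.coe_smul, inner_smul_right, inner_smul_right, Complex.re_ofReal_mul]
  have hnn : ∀ n, 0 ≤ (inner ℂ e (b n) * inner ℂ (b n) e).re := by
    intro n
    rw [← inner_conj_symm e (b n), Complex.conj_mul']
    norm_cast
    positivity
  have hsum : HasSum (fun n => ‖v‖ ^ p * (inner ℂ e (b n) * inner ℂ (b n) e).re) (‖v‖ ^ p) := by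
    have h := (Complex.hasSum_re (b.hasSum_inner_mul_inner e e)).mul_left (‖v‖ ^ p)
    simpa [inner_self_eq_norm_sq_to_K, he] using h
  simp only [hpow, hterm]
  rw [← ENNReal.ofReal_tsum_of_nonneg (fun n => mul_nonneg (by positivity) (hnn n)) hsum.summable,
    hsum.tsum_eq, ENNReal.ofReal_rpow_of_nonneg (by positivity) (by positivity),
    ← Real.rpow_mul (norm_nonneg _), mul_one_div_cancel hp.ne', Real.rpow_one]

/-! ### The Fourier transform of functions of the translation part -/

/-- The constant function `1`, as a unit vector of `L²(S¹)`. -/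
def constOne : H := basisH 0

theorem norm_constOne : ‖constOne‖ = 1 := basisH.orthonormal.1 0

theorem constOne_coeFn : constOne =ᵐ[AddCircle.haarAddCircle] fun _ => (1 : ℂ) := by
  have h := coeFn_fourierLp (T := 2 * Real.pi) 2 0
  rw [← coe_fourierBasis] at h
  filter_upwards [h] with θ hθ
  exact hθ.trans fourier_zero

theorem basisH_coeFn (n : ℤ) : basisH n =ᵐ[AddCircle.haarAddCircle] fourier n := by
  have h := coeFn_fourierLp (T := 2 * Real.pi) 2 n
  rwa [← coe_fourierBasis] at h

theorem rotOp_basisH (φ : S1) (n : ℤ) : rotOp φ (basisH n) = fourier (-n) φ • basisH n := by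
  apply Lp.ext
  filter_upwards [rotOp_coeFn φ (basisH n), basisH_coeFn n,
    (measurePreserving_sub φ).quasiMeasurePreserving.ae_eq_comp (basisH_coeFn n),
    Lp.coeFn_smul (fourier (-n) φ) (basisH n)] with θ h1 h2 h3 h4
  simp only [Function.comp_apply] at h3
  rw [h1, h3, h4, Pi.smul_apply, h2, smul_eq_mul]
  simp only [fourier_apply, sub_eq_add_neg, smul_add, AddCircle.toCircle_add, Circle.coe_mul,
    smul_neg, neg_smul]
  exact mul_comm _ _

theorem integral_fourier_eq_zero {n : ℤ} (hn : n ≠ 0) :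
    ∫ φ : S1, fourier (-n) φ = (0 : ℂ) := by
  have h : fourierCoeff (T := 2 * Real.pi) (fourier 0) n = 0 := by
    rw [fourierCoeff_fourier, Pi.single_eq_of_ne hn]
  simp only [fourierCoeff, fourier_zero, smul_eq_mul, mul_one] at h
  rw [AddCircle.volume_eq_smul_haarAddCircle, integral_smul_measure, h, smul_zero]

theorem integrable_comp_fst {f : ℂ → ℂ} (hf : Integrable f) :
    Integrable (fun x : M2 => f x.1) haar := hf.comp_fst _

/-- A rotation by `φ` multiplies `e^{inθ}` by `e^{-inφ}`. Since `f` does not see `φ`, the integral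
over `φ` kills every basis vector with `n ≠ 0`, and only the constants survive. -/
theorem groupFourier_comp_fst {f : ℂ → ℂ} (hf : Integrable f) (a : ℝ) :
    groupFourier (fun x => f x.1) a
      = rankOne ℂ (groupFourier (fun x => f x.1) a constOne) constOne := by
  apply ContinuousLinearMap.ext_on
    (Submodule.dense_iff_topologicalClosure_eq_top.2 basisH.dense_span)
  rintro _ ⟨n, rfl⟩
  rw [InnerProductSpace.rankOne_apply]
  have horth := orthonormal_iff_ite.1 basisH.orthonormal 0 n
  rw [constOne, horth]
  by_cases hn : n = 0
  · subst hn; simp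
  rw [if_neg (Ne.symm hn), zero_smul, groupFourier_apply (integrable_comp_fst hf)]
  have h1 : ∀ x : M2, f x.1 • rep a x (basisH n)
      = fourier (-n) x.2 • (f x.1 • mulOp (phase a x.1) (basisH n)) := by
    intro x
    change f x.1 • mulOp (phase a x.1) (rotOp x.2 (basisH n)) = _
    rw [rotOp_basisH, map_smul, smul_comm]
  simp only [h1]
  rw [← integral_prod_swap]
  simp only [Prod.fst_swap, Prod.snd_swap]
  rw [integral_prod_smul (μ := (volume : Measure S1)) (ν := (volume : Measure ℂ))
    (fun φ : S1 => (fourier (-n) φ : ℂ)) (fun z => f z • mulOp (phase a z) (basisH n)),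
    integral_fourier_eq_zero hn, zero_smul]

/-- The mean of `θ ↦ e^{i Re (a e^{-iθ} z)}`, that is, the value `J₀(a |z|)`. -/
def phaseMean (a : ℝ) (z : ℂ) : ℂ := ∫ θ, phase a z θ ∂AddCircle.haarAddCircle

theorem inner_rep_constOne (a : ℝ) (x : M2) :
    inner ℂ constOne (rep a x constOne) = phaseMean a x.1 := by
  rw [L2.inner_def, phaseMean]
  apply integral_congr_ae
  filter_upwards [constOne_coeFn, rep_coeFn a x.1 x.2 constOne,
    (measurePreserving_sub x.2).quasiMeasurePreserving.ae_eq_comp constOne_coeFn] with θ h1 h2 h3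
  simp only [Function.comp_apply] at h3
  rw [h1, h2, h3]
  simp [phase]

theorem norm_phaseMean_le (a : ℝ) (z : ℂ) : ‖phaseMean a z‖ ≤ 1 := by
  refine (norm_integral_le_integral_norm _).trans (le_of_eq ?_)
  simp [norm_phase]

theorem continuous_uncurry_phase :
    Continuous fun y : (ℝ × ℂ) × S1 => phase y.1.1 y.1.2 y.2 := by
  have := continuous_ei.comp (continuous_neg (G := S1))
  simp only [Function.comp_def] at this
  have h3 : Continuous fun y : (ℝ × ℂ) × S1 => ei (-y.2) := this.comp continuous_snd
  simp only [phase, ContinuousMap.coe_mk]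
  fun_prop

theorem stronglyMeasurable_phaseMean :
    StronglyMeasurable fun y : ℝ × ℂ => phaseMean y.1 y.2 :=
  StronglyMeasurable.integral_prod_right
    (f := fun y : ℝ × ℂ => fun θ : S1 => phase y.1 y.2 θ)
    continuous_uncurry_phase.stronglyMeasurable

theorem volume_real_S1 : (volume : Measure S1).real univ = 2 * Real.pi := by
  rw [measureReal_def, AddCircle.measure_univ, ENNReal.toReal_ofReal Real.two_pi_pos.le]

/-- The mean over the circle of radius `a` of the Euclidean Fourier transform of `f`, as a matrix
coefficient of the group Fourier transform. -/
def radialFourier (f : ℂ → ℂ) (a : ℝ) : ℂ :=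
  inner ℂ constOne (groupFourier (fun x => f x.1) a constOne)

theorem radialFourier_eq {f : ℂ → ℂ} (hf : Integrable f) (a : ℝ) :
    radialFourier f a = 2 * Real.pi * ∫ z, f z * phaseMean a z := by
  rw [radialFourier, groupFourier_apply (integrable_comp_fst hf),
    ← integral_inner (integrable_smul_rep (integrable_comp_fst hf) a constOne)]
  simp only [inner_smul_right, inner_rep_constOne]
  have h := integral_prod_mul (μ := (volume : Measure ℂ)) (ν := (volume : Measure S1))
    (fun z => f z * phaseMean a z) (fun _ => (1 : ℂ))
  simp only [mul_one, integral_const, volume_real_S1] at h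
  rw [h]
  simp [mul_comm]

theorem measurable_radialFourier {f : ℂ → ℂ} (hf : Integrable f) :
    AEStronglyMeasurable (radialFourier f) plancherel := by
  have h : radialFourier f = fun a => 2 * Real.pi * ∫ z, f z * phaseMean a z :=
    funext (radialFourier_eq hf)
  rw [h]
  refine AEStronglyMeasurable.const_mul ?_ _
  have : AEStronglyMeasurable (fun y : ℝ × ℂ => f y.2 * phaseMean y.1 y.2)
      (plancherel.prod volume) :=
    (hf.aestronglyMeasurable.comp_snd).mul stronglyMeasurable_phaseMean.aestronglyMeasurable
  exact this.integral_prod_right'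

theorem schattenNorm_groupFourier_comp_fst {f : ℂ → ℂ} (hf : Integrable f) {q : ℝ} (hq : 0 < q)
    (a : ℝ) : ENNReal.ofReal ‖radialFourier f a‖
      ≤ schattenNorm basisH q (groupFourier (fun x => f x.1) a) := by
  rw [groupFourier_comp_fst hf, schattenNorm_rankOne _ hq _ norm_constOne]
  refine ENNReal.ofReal_le_ofReal ((norm_inner_le_norm _ _).trans ?_)
  rw [norm_constOne, one_mul]

/-! ### Pairing with Gaussians -/

instance : SFinite plancherel := by
  unfold plancherel
  infer_instance

theorem integral_plancherel {E : Type*} [NormedAddCommGroup E] [NormedSpace ℝ E] (F : ℝ → E) :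
    ∫ a, F a ∂plancherel = ∫ a in Ioi (0 : ℝ), a • F a := by
  rw [plancherel, integral_withDensity_eq_integral_toReal_smul ENNReal.measurable_ofReal
    (Filter.Eventually.of_forall fun _ => ENNReal.ofReal_lt_top)]
  refine setIntegral_congr_fun measurableSet_Ioi fun a ha => ?_
  simp only [ENNReal.toReal_ofReal (le_of_lt ha)]

theorem lintegral_plancherel (F : ℝ → ℝ≥0∞) :
    ∫⁻ a, F a ∂plancherel = ∫⁻ a in Ioi (0 : ℝ), F a * ENNReal.ofReal a := by
  rw [plancherel, lintegral_withDensity_eq_lintegral_mul_non_measurable _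
    ENNReal.measurable_ofReal (Filter.Eventually.of_forall fun _ => ENNReal.ofReal_lt_top)]
  simp [mul_comm]

theorem integrable_plancherel_iff {E : Type*} [NormedAddCommGroup E] [NormedSpace ℝ E]
    (F : ℝ → E) : Integrable F plancherel ↔ IntegrableOn (fun a => a • F a) (Ioi 0) := by
  rw [plancherel, integrable_withDensity_iff_integrable_smul' ENNReal.measurable_ofReal
    (Filter.Eventually.of_forall fun _ => ENNReal.ofReal_lt_top), IntegrableOn]
  refine integrable_congr ?_
  filter_upwards [ae_restrict_mem measurableSet_Ioi] with a ha
  simp only [ENNReal.toReal_ofReal (le_of_lt ha)]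

theorem integrable_gaussian_plancherel {t : ℝ} (ht : 0 < t) :
    Integrable (fun a : ℝ => Real.exp (-t * a ^ 2)) plancherel := by
  rw [integrable_plancherel_iff]
  exact (integrable_mul_exp_neg_mul_sq ht).integrableOn

theorem phase_coe (a : ℝ) (z : ℂ) (s : ℝ) : phase a z (s : S1)
    = Complex.exp (Complex.I * (inner ℝ z (a * (Real.cos s + Real.sin s * Complex.I)) : ℝ)) := by
  simp only [phase, ContinuousMap.coe_mk]
  have h : ei (-(s : S1)) = Complex.exp (((-s : ℝ) : ℂ) * Complex.I) := by
    rw [← ei_coe]; rfl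
  rw [h, Complex.exp_mul_I, Complex.inner]
  congr 3
  simp [← Complex.ofReal_cos, ← Complex.ofReal_sin]

theorem setIntegral_phase (a : ℝ) (z : ℂ) :
    ∫ s in Ioo (-Real.pi) Real.pi, phase a z (s : S1) = 2 * Real.pi * phaseMean a z := by
  have h := AddCircle.integral_preimage (2 * Real.pi) (-Real.pi) (fun θ => phase a z θ)
  have h2 : -Real.pi + 2 * Real.pi = Real.pi := by ring
  rw [h2] at h
  rw [← integral_Ioc_eq_integral_Ioo, h, AddCircle.volume_eq_smul_haarAddCircle,
    integral_smul_measure, ENNReal.toReal_ofReal Real.two_pi_pos.le, phaseMean, Complex.real_smul]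
  push_cast
  rfl

/-- In polar coordinates the left side, times `2π`, is the Fourier integral of a Gaussian on `ℂ`: `a
da` is the radial part of Lebesgue measure and `phaseMean` the angular average of the character. -/
theorem integral_gaussian_mul_phaseMean {t : ℝ} (ht : 0 < t) (z : ℂ) :
    ∫ a, (Real.exp (-t * a ^ 2) : ℂ) * phaseMean a z ∂plancherel
      = ((1 / (2 * t) * Real.exp (-(‖z‖ ^ 2 / (4 * t))) : ℝ) : ℂ) := by
  have h1 := GaussianFourier.integral_cexp_neg_mul_sq_norm_add (b := (t : ℂ)) (by simpa using ht)
    Complex.I z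
  rw [← Complex.integral_comp_polarCoord_symm, polarCoord_target, Measure.volume_eq_prod,
    setIntegral_prod] at h1
  · have h2 : ∀ a ∈ Ioi (0 : ℝ), (∫ s in Ioo (-Real.pi) Real.pi, (a, s).1 •
        Complex.exp (-(t : ℂ) * ‖Complex.polarCoord.symm (a, s)‖ ^ 2
          + Complex.I * (inner ℝ z (Complex.polarCoord.symm (a, s)) : ℝ)))
        = (2 * Real.pi) * (a • ((Real.exp (-t * a ^ 2) : ℂ) * phaseMean a z)) := by
      intro a ha
      have h3 : ∀ s : ℝ, (a, s).1 •
          Complex.exp (-(t : ℂ) * ‖Complex.polarCoord.symm (a, s)‖ ^ 2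
            + Complex.I * (inner ℝ z (Complex.polarCoord.symm (a, s)) : ℝ))
          = (a * (Real.exp (-t * a ^ 2) : ℂ)) * phase a z (s : S1) := by
        intro s
        have hn : ‖Complex.polarCoord.symm (a, s)‖ = a := by
          rw [Complex.norm_polarCoord_symm, abs_of_pos ha]
        rw [hn, Complex.exp_add, phase_coe, Complex.polarCoord_symm_apply, Complex.real_smul]
        push_cast
        ring
      simp only [h3]
      rw [integral_const_mul, setIntegral_phase, Complex.real_smul]
      ring
    rw [setIntegral_congr_fun measurableSet_Ioi h2, integral_const_mul,
      ← integral_plancherel] at h1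
    have hpi : (2 * Real.pi : ℂ) ≠ 0 := by
      exact_mod_cast Real.two_pi_pos.ne'
    apply mul_left_cancel₀ hpi
    rw [h1, Complex.finrank_real_complex]
    have htc : (t : ℂ) ≠ 0 := by exact_mod_cast ht.ne'
    push_cast
    rw [div_self (two_ne_zero), Complex.cpow_one, Complex.I_sq]
    rw [show (-1 * (‖z‖ : ℂ) ^ 2 / (4 * t)) = -((‖z‖ : ℂ) ^ 2 / (4 * t)) by ring]
    field_simp
  -- Fubini in polar coordinates: the integrand has modulus `a e^{-ta²}`, on a bounded range of
  -- angles.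
  · have h4 : Integrable (fun y : ℝ × ℝ => (y.1 * Real.exp (-t * y.1 ^ 2)) * 1)
        ((volume.restrict (Ioi 0)).prod (volume.restrict (Ioo (-Real.pi) Real.pi))) :=
      Integrable.mul_prod (integrable_mul_exp_neg_mul_sq ht).integrableOn (integrable_const 1)
    rw [IntegrableOn, ← Measure.prod_restrict]
    refine h4.mono ?_ ?_
    · have : Continuous fun p : ℝ × ℝ => (Complex.polarCoord.symm p : ℂ) := by
        simp only [Complex.polarCoord_symm_apply]
        fun_prop
      apply Continuous.aestronglyMeasurable
      fun_prop
    · refine Filter.Eventually.of_forall fun p => le_of_eq ?_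
      rw [norm_smul, Complex.norm_exp]
      simp
      left
      simp [← Complex.ofReal_pow]

theorem integral_gaussian_mul_radialFourier {f : ℂ → ℂ} (hf : Integrable f) {t : ℝ} (ht : 0 < t) :
    ∫ a, (Real.exp (-t * a ^ 2) : ℂ) * radialFourier f a ∂plancherel
      = (Real.pi / t : ℝ) * ∫ z, f z * (Real.exp (-(‖z‖ ^ 2 / (4 * t))) : ℝ) := by
  have hg : Integrable (fun a : ℝ => (Real.exp (-t * a ^ 2) : ℂ)) plancherel :=
    (integrable_gaussian_plancherel ht).ofReal
  have hint : Integrable (Function.uncurry fun (a : ℝ) (z : ℂ) =>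
      (Real.exp (-t * a ^ 2) : ℂ) * f z * phaseMean a z) (plancherel.prod volume) :=
    (hg.mul_prod hf).mul_bdd (c := 1) stronglyMeasurable_phaseMean.aestronglyMeasurable
      (Filter.Eventually.of_forall fun y => norm_phaseMean_le y.1 y.2)
  have h1 : ∀ a : ℝ, (Real.exp (-t * a ^ 2) : ℂ) * radialFourier f a
      = 2 * Real.pi * ∫ z, (Real.exp (-t * a ^ 2) : ℂ) * f z * phaseMean a z := by
    intro a
    simp only [mul_assoc]
    rw [radialFourier_eq hf, integral_const_mul]
    ring
  simp only [h1]
  rw [integral_const_mul, integral_integral_swap hint, ← integral_const_mul, ← integral_const_mul]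
  refine integral_congr_ae (Filter.Eventually.of_forall fun z => ?_)
  have h2 : ∀ a : ℝ, (Real.exp (-t * a ^ 2) : ℂ) * f z * phaseMean a z
      = f z * ((Real.exp (-t * a ^ 2) : ℂ) * phaseMean a z) := fun a => by ring
  simp only [h2]
  rw [integral_const_mul, integral_gaussian_mul_phaseMean ht]
  have htc : (t : ℂ) ≠ 0 := by exact_mod_cast ht.ne'
  push_cast
  field_simp

/-! ### The Wigner transform against symbols of rank one -/

theorem groupFourier_congr {f g : M2 → ℂ} (h : f =ᵐ[haar] g) (a : ℝ) :
    groupFourier f a = groupFourier g a := by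
  by_cases hf : Integrable f haar
  · ext1 u
    rw [groupFourier_apply hf, groupFourier_apply (hf.congr h)]
    exact integral_congr_ae (h.mono fun x hx => by simp only [hx])
  · rw [groupFourier, groupFourier, dif_neg hf, dif_neg fun hg => hf (hg.congr h.symm)]

theorem inv_mul_eq (x y : M2) :
    x⁻¹ * y = (-(ei (-x.2) * x.1) + ei (-x.2) * y.1, -x.2 + y.2) := rfl

/-- A skew product: a reflection and translation of the circle, and over each fixed angle an
isometry of the plane. It allows `g` in the Wigner transform to be changed on a null set. -/
theorem measurePreserving_inv_mul (y : M2) :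
    MeasurePreserving (fun x : M2 => x⁻¹ * y) haar haar := by
  have hei : Continuous fun φ : S1 => ei (-φ) := continuous_ei.comp continuous_neg
  have h1 : MeasurePreserving (fun φ : S1 => -φ + y.2) volume volume :=
    (measurePreserving_add_right volume y.2).comp (Measure.measurePreserving_neg volume)
  have h2 : ∀ φ : S1, MeasurePreserving (fun z : ℂ => -(ei (-φ) * z) + ei (-φ) * y.1)
      volume volume := fun φ =>
    (measurePreserving_add_right volume (ei (-φ) * y.1)).comp
      ((Measure.measurePreserving_neg volume).comp
        (rotation (AddCircle.toCircle (-φ))).measurePreserving)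
  have h3 : MeasurePreserving
      (fun p : S1 × ℂ => (-p.1 + y.2, -(ei (-p.1) * p.2) + ei (-p.1) * y.1))
      (volume.prod volume) (volume.prod volume) :=
    h1.skew_product (g := fun φ z => -(ei (-φ) * z) + ei (-φ) * y.1)
      (Continuous.measurable (by
        have := hei.comp (continuous_fst (X := S1) (Y := ℂ))
        simp only [Function.comp_def] at this
        simp only [Function.uncurry_def]
        fun_prop))
      (Filter.Eventually.of_forall fun φ => (h2 φ).map_eq)
  exact Measure.measurePreserving_swap.comp (h3.comp Measure.measurePreserving_swap)

theorem norm_ei (θ : S1) : ‖ei θ‖ = 1 := Circle.norm_coe _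

theorem wigner_eq_groupFourier {f : ℂ → ℂ} (hsupp : ∀ z, 1 ≤ ‖z‖ → f z = 0) {F G : M2 → ℂ}
    (hF : F =ᵐ[haar] fun x => f x.1)
    (hG : G =ᵐ[haar] fun x => (Metric.ball (0 : ℂ) 2).indicator 1 x.1)
    {y : M2} (hy : ‖y.1‖ < 1) (a : ℝ) :
    wigner F G y a = groupFourier (fun x => f x.1) a := by
  apply groupFourier_congr
  filter_upwards [hF, (measurePreserving_inv_mul y).quasiMeasurePreserving.ae_eq_comp hG]
    with x h1 h2
  simp only [Function.comp_apply] at h2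
  rw [h1, h2]
  by_cases hx : 1 ≤ ‖x.1‖
  · rw [hsupp _ hx, zero_mul]
  -- Both translation parts have modulus below `1`, so that of `x⁻¹ y` is below `2` and the second
  -- factor equals `1`.
  · have : (x⁻¹ * y).1 ∈ Metric.ball (0 : ℂ) 2 := by
      rw [inv_mul_eq, mem_ball_zero_iff]
      calc ‖-(ei (-x.2) * x.1) + ei (-x.2) * y.1‖
          ≤ ‖-(ei (-x.2) * x.1)‖ + ‖ei (-x.2) * y.1‖ := norm_add_le _ _
        _ < 2 := by
          rw [norm_neg, norm_mul, norm_mul, norm_ei]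
          push Not at hx
          linarith
    rw [indicator_of_mem this, Pi.one_apply, mul_one]

/-- The characteristic function of the unit disc. -/
def discInd (z : ℂ) : ℝ := (Metric.ball (0 : ℂ) 1).indicator 1 z

theorem discInd_nonneg (z : ℂ) : 0 ≤ discInd z :=
  indicator_nonneg (fun _ _ => zero_le_one) z

theorem measurable_discInd : Measurable discInd :=
  measurable_one.indicator Metric.isOpen_ball.measurableSet

/-- The symbol `χ(z) h(a) P`, where `χ` is the characteristic function of the unit disc and `P` the
projection onto the constant functions. -/
def diskSymbol (h : ℝ → ℝ) (x : M2) (a : ℝ) : H →L[ℂ] H :=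
  rankOne ℂ (((discInd x.1 * h a : ℝ) : ℂ) • constOne) constOne

theorem adjoint_diskSymbol_mul_wigner {f : ℂ → ℂ} (hf : Integrable f)
    (hsupp : ∀ z, 1 ≤ ‖z‖ → f z = 0) {F G : M2 → ℂ} (hF : F =ᵐ[haar] fun x => f x.1)
    (hG : G =ᵐ[haar] fun x => (Metric.ball (0 : ℂ) 2).indicator 1 x.1)
    (h : ℝ → ℝ) (x : M2) (a : ℝ) :
    ContinuousLinearMap.adjoint (diskSymbol h x a) * wigner F G x a
      = rankOne ℂ (((discInd x.1 : ℂ) * (h a * radialFourier f a)) • constOne) constOne := by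
  by_cases hx : ‖x.1‖ < 1
  · rw [wigner_eq_groupFourier hsupp hF hG hx, groupFourier_comp_fst hf, diskSymbol]
    ext1 u
    simp only [InnerProductSpace.adjoint_rankOne, mul_apply_eq_comp,
      InnerProductSpace.rankOne_apply, inner_smul_right, inner_smul_left, Complex.conj_ofReal,
      smul_smul]
    rw [radialFourier]
    push_cast
    ring_nf
  · have h0 : discInd x.1 = 0 := indicator_of_notMem (by simpa using hx) _
    simp [diskSymbol, h0]

theorem pairingIntegrand_diskSymbol {f : ℂ → ℂ} (hf : Integrable f)
    (hsupp : ∀ z, 1 ≤ ‖z‖ → f z = 0) {F G : M2 → ℂ} (hF : F =ᵐ[haar] fun x => f x.1)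
    (hG : G =ᵐ[haar] fun x => (Metric.ball (0 : ℂ) 2).indicator 1 x.1) (h : ℝ → ℝ) :
    pairingIntegrand (diskSymbol h) F G
      = fun y => (discInd y.1.1 : ℂ) * (h y.2 * radialFourier f y.2) := by
  funext y
  rw [pairingIntegrand, adjoint_diskSymbol_mul_wigner hf hsupp hF hG, opTrace_rankOne,
    inner_smul_right, inner_self_eq_norm_sq_to_K, norm_constOne]
  simp

theorem integral_discInd : ∫ x : M2, (discInd x.1 : ℂ) ∂haar = 2 * Real.pi ^ 2 := by
  have h := integral_prod_mul (μ := (volume : Measure ℂ)) (ν := (volume : Measure S1))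
    (fun z => (discInd z : ℂ)) (fun _ => (1 : ℂ))
  simp only [mul_one, integral_const, volume_real_S1] at h
  rw [h, integral_complex_ofReal]
  simp only [discInd]
  rw [integral_indicator_one Metric.isOpen_ball.measurableSet, measureReal_def,
    Complex.volume_ball]
  simp
  ring

theorem integrable_discInd : Integrable (fun x : M2 => (discInd x.1 : ℂ)) haar := by
  have h : Integrable discInd :=
    (integrable_indicator_iff Metric.isOpen_ball.measurableSet).2
      (integrableOn_const measure_ball_lt_top.ne)
  have h2 : Integrable fun z => (discInd z : ℂ) := h.ofReal
  exact h2.comp_fst _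

theorem pairing_diskSymbol {f : ℂ → ℂ} (hf : Integrable f)
    (hsupp : ∀ z, 1 ≤ ‖z‖ → f z = 0) {F G : M2 → ℂ} (hF : F =ᵐ[haar] fun x => f x.1)
    (hG : G =ᵐ[haar] fun x => (Metric.ball (0 : ℂ) 2).indicator 1 x.1) (h : ℝ → ℝ) :
    pairing (diskSymbol h) F G
      = 2 * Real.pi ^ 2 * ∫ a, (h a : ℂ) * radialFourier f a ∂plancherel := by
  rw [pairing, pairingIntegrand_diskSymbol hf hsupp hF hG, ← integral_discInd]
  exact integral_prod_mul (μ := haar) (ν := plancherel) (fun x : M2 => (discInd x.1 : ℂ))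
    (fun a => (h a : ℂ) * radialFourier f a)

theorem pairingConverges_diskSymbol {f : ℂ → ℂ} (hf : Integrable f)
    (hsupp : ∀ z, 1 ≤ ‖z‖ → f z = 0) {F G : M2 → ℂ} (hF : F =ᵐ[haar] fun x => f x.1)
    (hG : G =ᵐ[haar] fun x => (Metric.ball (0 : ℂ) 2).indicator 1 x.1) {h : ℝ → ℝ}
    (hint : Integrable (fun a => (h a : ℂ) * radialFourier f a) plancherel) :
    PairingConverges (diskSymbol h) F G := by
  refine ⟨Filter.Eventually.of_forall fun y => ?_, ?_⟩
  · rw [adjoint_diskSymbol_mul_wigner hf hsupp hF hG,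
      schattenNorm_rankOne _ one_pos _ norm_constOne]
    exact ENNReal.ofReal_lt_top
  · rw [pairingIntegrand_diskSymbol hf hsupp hF hG]
    exact integrable_discInd.mul_prod hint

/-! ### Norms of symbols -/

theorem schattenNorm_diskSymbol {p : ℝ} (hp : 0 < p) (h : ℝ → ℝ) (x : M2) (a : ℝ) :
    schattenNorm basisH p (diskSymbol h x a) = ENNReal.ofReal (discInd x.1 * |h a|) := by
  rw [diskSymbol, schattenNorm_rankOne _ hp _ norm_constOne, norm_smul, norm_constOne, mul_one,
    Complex.norm_real, Real.norm_eq_abs, abs_mul, abs_of_nonneg (discInd_nonneg _)]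

/-- Up to a constant, `a da` is the radial part of Lebesgue measure on `ℂ`, so the condition is `r >
dim ℂ = 2`. -/
theorem integrable_japanese_plancherel {r : ℝ} (hr : 2 < r) :
    Integrable (fun a : ℝ => (1 + a ^ 2) ^ (-r / 2)) plancherel := by
  have h := integrable_rpow_neg_one_add_norm_sq (E := ℂ) (μ := volume) (r := r)
    (by rw [Complex.finrank_real_complex]; exact_mod_cast hr)
  rw [integrable_plancherel_iff]
  have h2 := (integrable_fun_norm_addHaar (volume : Measure ℂ)
    (f := fun y : ℝ => (1 + y ^ 2) ^ (-r / 2))).1 h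
  simpa [Complex.finrank_real_complex] using h2

theorem lintegral_japanese_rpow_ne_top {p s : ℝ} (hp : 0 < p) (hs : 2 < s * p) :
    ∫⁻ a, ENNReal.ofReal ((1 + a ^ 2) ^ (-s / 2)) ^ p ∂plancherel ≠ ∞ := by
  have h1 : ∀ a : ℝ, ENNReal.ofReal ((1 + a ^ 2) ^ (-s / 2)) ^ p
      = ENNReal.ofReal ((1 + a ^ 2) ^ (-(s * p) / 2)) := by
    intro a
    rw [ENNReal.ofReal_rpow_of_nonneg (by positivity) hp.le, ← Real.rpow_mul (by positivity)]
    congr 2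
    ring
  simp only [h1]
  exact (integrable_japanese_plancherel hs).lintegral_lt_top.ne

/-- The point is that `M` does not depend on `h`, so that one constant serves Gaussians of all
scales. -/
theorem exists_symbolNorm_diskSymbol_le {p s : ℝ} (hp : 0 < p) (hs : 2 < s * p) :
    ∃ M : ℝ, 0 ≤ M ∧ ∀ (h : ℝ → ℝ) (K : ℝ), 0 ≤ K → (∀ a, |h a| ≤ K * (1 + a ^ 2) ^ (-s / 2)) →
      symbolNorm p (diskSymbol h) ≤ ENNReal.ofReal (K * M) := by
  set I : ℝ≥0∞ := ∫⁻ y : M2 × ℝ,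
    (ENNReal.ofReal (discInd y.1.1) ^ p) * ENNReal.ofReal ((1 + y.2 ^ 2) ^ (-s / 2)) ^ p
      ∂(haar.prod plancherel) with hI
  have hIfin : I ≠ ∞ := by
    rw [hI, lintegral_prod_mul (μ := haar) (ν := plancherel)
      (f := fun x : M2 => ENNReal.ofReal (discInd x.1) ^ p)
      (g := fun a => ENNReal.ofReal ((1 + a ^ 2) ^ (-s / 2)) ^ p)
      (((measurable_discInd.comp measurable_fst).ennreal_ofReal.pow_const p).aemeasurable)
      (by fun_prop)]
    apply ENNReal.mul_ne_top
    · have h1 : ∀ x : M2, ENNReal.ofReal (discInd x.1) ^ p = ENNReal.ofReal (discInd x.1) := by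
        intro x
        by_cases hx : x.1 ∈ Metric.ball (0 : ℂ) 1
        · simp [discInd, indicator_of_mem hx]
        · simp [discInd, indicator_of_notMem hx, hp]
      simp only [h1]
      have := integrable_discInd.norm.lintegral_lt_top
      simpa [abs_of_nonneg (discInd_nonneg _)] using this.ne
    · exact lintegral_japanese_rpow_ne_top hp hs
  have hI' : I ^ (1 / p) ≠ ∞ := ENNReal.rpow_ne_top_of_nonneg (by positivity) hIfin
  refine ⟨(I ^ (1 / p)).toReal, ENNReal.toReal_nonneg, fun h K hK hh => ?_⟩
  rw [ENNReal.ofReal_mul hK, ENNReal.ofReal_toReal hI', symbolNorm]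
  have hle : ∫⁻ y : M2 × ℝ, schattenNorm basisH p (diskSymbol h y.1 y.2) ^ p ∂(haar.prod plancherel)
      ≤ ENNReal.ofReal K ^ p * I := by
    rw [hI, ← lintegral_const_mul' _ _ (ENNReal.rpow_ne_top_of_nonneg hp.le ENNReal.ofReal_ne_top)]
    refine lintegral_mono fun y => ?_
    simp only []
    rw [schattenNorm_diskSymbol hp, ← ENNReal.mul_rpow_of_nonneg _ _ hp.le,
      ← ENNReal.mul_rpow_of_nonneg _ _ hp.le, ← ENNReal.ofReal_mul (discInd_nonneg _),
      ← ENNReal.ofReal_mul hK]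
    refine ENNReal.rpow_le_rpow (ENNReal.ofReal_le_ofReal ?_) hp.le
    calc discInd y.1.1 * |h y.2| ≤ discInd y.1.1 * (K * (1 + y.2 ^ 2) ^ (-s / 2)) :=
          mul_le_mul_of_nonneg_left (hh _) (discInd_nonneg _)
      _ = _ := by ring
  refine (ENNReal.rpow_le_rpow hle (by positivity)).trans (le_of_eq ?_)
  rw [ENNReal.mul_rpow_of_nonneg _ _ (by positivity), ← ENNReal.rpow_mul,
    mul_one_div_cancel hp.ne', ENNReal.rpow_one]

theorem memSymbol_diskSymbol {p s K : ℝ} (hp : 0 < p) (hs : 2 < s * p) {h : ℝ → ℝ}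
    (hm : Measurable h) (hK : 0 ≤ K) (hh : ∀ a, |h a| ≤ K * (1 + a ^ 2) ^ (-s / 2)) :
    MemSymbol p (diskSymbol h) := by
  obtain ⟨M, -, hM⟩ := exists_symbolNorm_diskSymbol_le hp hs
  refine ⟨fun u v => ?_, (hM h K hK hh).trans_lt ENNReal.ofReal_lt_top⟩
  simp only [diskSymbol, InnerProductSpace.rankOne_apply, inner_smul_right]
  refine (Measurable.aestronglyMeasurable ?_)
  have h1 : Measurable fun y : M2 × ℝ => discInd y.1.1 :=
    measurable_discInd.comp (measurable_fst.comp measurable_fst)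
  fun_prop

/-! ### Gaussian test functions -/

/-- From `e^x ≥ 1 + x` with `x = r²a²`, raised to the power `s/2 ≤ 1`, and `1 + r²a² ≥ r²(1 + a²)`
for `r ≤ 1`. -/
theorem gaussian_le_japanese {r s : ℝ} (hr : 0 < r) (hr1 : r ≤ 1) (hs0 : 0 ≤ s) (hs2 : s ≤ 2)
    (a : ℝ) : Real.exp (-r ^ 2 * a ^ 2) ≤ r ^ (-s) * (1 + a ^ 2) ^ (-s / 2) := by
  have hr2 : r ^ 2 ≤ 1 := pow_le_one₀ hr.le hr1
  have h1 : r ^ 2 * (1 + a ^ 2) ≤ 1 + r ^ 2 * a ^ 2 := by linarith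
  have h2 : (r ^ 2 * (1 + a ^ 2)) ^ (s / 2) ≤ Real.exp (r ^ 2 * a ^ 2) := by
    calc (r ^ 2 * (1 + a ^ 2)) ^ (s / 2) ≤ (1 + r ^ 2 * a ^ 2) ^ (s / 2) :=
          Real.rpow_le_rpow (by positivity) h1 (by positivity)
      _ ≤ (1 + r ^ 2 * a ^ 2) ^ (1 : ℝ) :=
          Real.rpow_le_rpow_of_exponent_le (by nlinarith [sq_nonneg (r * a)]) (by linarith)
      _ ≤ Real.exp (r ^ 2 * a ^ 2) := by
          rw [Real.rpow_one, add_comm]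
          exact Real.add_one_le_exp _
  have h3 : r ^ (-s) * (1 + a ^ 2) ^ (-s / 2) = ((r ^ 2 * (1 + a ^ 2)) ^ (s / 2))⁻¹ := by
    rw [← Real.rpow_neg (by positivity), Real.mul_rpow (by positivity) (by positivity),
      ← Real.rpow_natCast r 2, ← Real.rpow_mul hr.le]
    congr 2 <;> push_cast <;> ring
  rw [h3, neg_mul, Real.exp_neg]
  exact inv_anti₀ (by positivity) h2

/-- The pairing of `φ` with the Euclidean Fourier transform of `w ↦ e^{-r² |w|²}`. -/
def gaussPair (r : ℝ) (φ : ℂ → ℝ) : ℝ :=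
  Real.pi / r ^ 2 * ∫ z, φ z * Real.exp (-(‖z‖ ^ 2 / (4 * r ^ 2)))

theorem integral_gaussian_mul_radialFourier_ofReal {φ : ℂ → ℝ} (hφ : Integrable φ) {r : ℝ}
    (hr : 0 < r) : ∫ a, ((Real.exp (-r ^ 2 * a ^ 2) : ℝ) : ℂ) * radialFourier (fun z => φ z) a
      ∂plancherel = gaussPair r φ := by
  have hf : Integrable fun z => (φ z : ℂ) := hφ.ofReal
  rw [integral_gaussian_mul_radialFourier hf (by positivity), gaussPair, Complex.ofReal_mul,
    ← integral_complex_ofReal]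
  simp only [Complex.ofReal_mul]

theorem gaussPair_nonneg {φ : ℂ → ℝ} (h0 : ∀ z, 0 ≤ φ z) (r : ℝ) : 0 ≤ gaussPair r φ :=
  mul_nonneg (div_nonneg Real.pi_pos.le (sq_nonneg r))
    (integral_nonneg fun z => mul_nonneg (h0 z) (Real.exp_pos _).le)

/-- A lower bound for Gaussian pairings. -/
def gaussConst : ℝ := Real.pi ^ 2 * Real.exp (-(1 / 4))

theorem gaussConst_pos : 0 < gaussConst := by
  unfold gaussConst
  positivity

/-- On the disc of radius `r` the weight is at least `e^{-1/4}`, and the area `πr²` cancels the `r`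
in the prefactor `π/r²`; hence a constant free of `r`. -/
theorem le_gaussPair {φ : ℂ → ℝ} (hφ : Integrable φ) (h0 : ∀ z, 0 ≤ φ z) {r m : ℝ} (hr : 0 < r)
    (h : ∀ᵐ z, z ∈ Metric.ball (0 : ℂ) r → m ≤ φ z) :
    gaussConst * m ≤ gaussPair r φ := by
  have hint : Integrable fun z => φ z * Real.exp (-(‖z‖ ^ 2 / (4 * r ^ 2))) := by
    refine hφ.mul_bdd (c := 1) (Continuous.aestronglyMeasurable (by fun_prop))
      (Filter.Eventually.of_forall fun z => ?_)
    rw [Real.norm_eq_abs, Real.abs_exp, Real.exp_le_one_iff, neg_nonpos]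
    positivity
  have h1 : ∫ z in Metric.ball (0 : ℂ) r, m * Real.exp (-(1 / 4))
      ≤ ∫ z in Metric.ball (0 : ℂ) r, φ z * Real.exp (-(‖z‖ ^ 2 / (4 * r ^ 2))) := by
    refine setIntegral_mono_on_ae (integrableOn_const measure_ball_lt_top.ne)
      hint.integrableOn Metric.isOpen_ball.measurableSet ?_
    filter_upwards [h] with z hz hzr
    refine mul_le_mul (hz hzr) ?_ (Real.exp_pos _).le (h0 z)
    rw [Real.exp_le_exp, neg_le_neg_iff, div_le_div_iff₀ (by positivity) (by positivity)]
    have : ‖z‖ ^ 2 ≤ r ^ 2 := by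
      rw [mem_ball_zero_iff] at hzr
      exact pow_le_pow_left₀ (norm_nonneg _) hzr.le 2
    linarith
  have h2 := setIntegral_le_integral hint (s := Metric.ball (0 : ℂ) r)
    (Filter.Eventually.of_forall fun z => mul_nonneg (h0 z) (Real.exp_pos _).le)
  rw [setIntegral_const, measureReal_def, Complex.volume_ball] at h1
  simp only [ENNReal.toReal_mul, ENNReal.toReal_pow, ENNReal.toReal_ofReal hr.le,
    ENNReal.coe_toReal, NNReal.coe_real_pi, smul_eq_mul] at h1
  calc gaussConst * m = Real.pi / r ^ 2 * (r ^ 2 * Real.pi * (m * Real.exp (-(1 / 4)))) := by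
        rw [gaussConst]
        field_simp
    _ ≤ _ := mul_le_mul_of_nonneg_left (h1.trans h2) (by positivity)

/-- The ratio of the two powers is `2^{(β-s)(N+1)}`, which is unbounded. The exponent `N + 1`
instead of `N` keeps `2r ≤ 1`, which confines the bumps used below to the unit disc. -/
theorem not_forall_rpow_le {s β c M : ℝ} (hsβ : s < β) (hc : 0 < c) :
    ¬ ∀ N : ℕ, c * ((1 / 2 : ℝ) ^ (N + 1)) ^ (-β) ≤ M * ((1 / 2 : ℝ) ^ (N + 1)) ^ (-s) := by
  intro h
  have h1 : 1 < (2 : ℝ) ^ (β - s) := Real.one_lt_rpow one_lt_two (by linarith)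
  obtain ⟨n, hn⟩ := pow_unbounded_of_one_lt (M / c) h1
  have h2 := h n
  have hr : (0 : ℝ) < (1 / 2 : ℝ) ^ (n + 1) := by positivity
  have h3 : ((1 / 2 : ℝ) ^ (n + 1)) ^ (-β)
      = ((2 : ℝ) ^ (β - s)) ^ (n + 1) * ((1 / 2 : ℝ) ^ (n + 1)) ^ (-s) := by
    have h4 : ((2 : ℝ) ^ (β - s)) ^ (n + 1) = ((1 / 2 : ℝ) ^ (n + 1)) ^ (-(β - s)) := by
      rw [← Real.rpow_natCast, ← Real.rpow_natCast, ← Real.rpow_mul (by norm_num),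
        ← Real.rpow_mul (by norm_num), one_div, Real.inv_rpow (by norm_num), ← Real.rpow_neg
        (by norm_num)]
      congr 1
      ring
    rw [h4, ← Real.rpow_add hr]
    congr 1
    ring
  rw [h3, ← mul_assoc] at h2
  have h5 := le_of_mul_le_mul_right h2 (Real.rpow_pos_of_pos hr _)
  have h6 : (2 : ℝ) ^ (β - s) ^ 1 = 2 ^ (β - s) := by rw [pow_one]
  have h7 : M / c < ((2 : ℝ) ^ (β - s)) ^ (n + 1) :=
    hn.trans_le (pow_le_pow_right₀ h1.le (Nat.le_succ n))
  rw [div_lt_iff₀ hc] at h7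
  linarith

/-! ### The function `f_β` -/

/-- The function `χ_{B_1(0)}(z) |z|^{-β}` on the plane. -/
def cutPower (β : ℝ) (z : ℂ) : ℝ := (Metric.ball (0 : ℂ) 1).indicator (fun z => ‖z‖ ^ (-β)) z

theorem fBeta_eq (β : ℝ) : fBeta β = fun x : M2 => (cutPower β x.1 : ℂ) := by
  funext x
  simp only [fBeta, cutPower, indicator]
  split_ifs <;> simp

theorem cutPower_nonneg (β : ℝ) (z : ℂ) : 0 ≤ cutPower β z :=
  indicator_nonneg (fun _ _ => by positivity) z

theorem measurable_cutPower (β : ℝ) : Measurable (cutPower β) :=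
  Measurable.indicator (by fun_prop) Metric.isOpen_ball.measurableSet

theorem integrable_cutPower {β : ℝ} (hβ : β < 2) : Integrable (cutPower β) := by
  have h : IntegrableOn (fun z : ℂ => ‖z‖ ^ (-β)) (Metric.ball 0 1) :=
    integrableOn_ball_of_norm_le_rpow (C := 1) (α := β)
      (by rw [Complex.finrank_real_complex]; norm_num)
      (by rw [Complex.finrank_real_complex]; exact_mod_cast hβ)
      (Filter.Eventually.of_forall fun z => by
        rw [one_mul, Real.norm_of_nonneg (by positivity)])
      (Measurable.aestronglyMeasurable (by fun_prop))
  exact (integrable_indicator_iff Metric.isOpen_ball.measurableSet).2 h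

theorem cutPower_sq (β : ℝ) (z : ℂ) : cutPower β z ^ 2 = cutPower (2 * β) z := by
  simp only [cutPower, indicator]
  split_ifs
  · rw [← Real.rpow_natCast, ← Real.rpow_mul (norm_nonneg _)]
    congr 1
    push_cast
    ring
  · simp

theorem memLp_fBeta {β : ℝ} (hβ : β < 1) : MemLp (fBeta β) 2 haar := by
  have hm : Measurable fun x : M2 => (cutPower β x.1 : ℂ) :=
    Complex.measurable_ofReal.comp ((measurable_cutPower β).comp measurable_fst)
  rw [fBeta_eq, memLp_two_iff_integrable_sq_norm hm.aestronglyMeasurable]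
  simp only [Complex.norm_real, Real.norm_eq_abs, sq_abs, cutPower_sq]
  exact (integrable_cutPower (by linarith)).comp_fst _

theorem hasCompactSupport_fBeta (β : ℝ) : HasCompactSupport (fBeta β) := by
  refine HasCompactSupport.intro (K := Metric.closedBall (0 : ℂ) 1 ×ˢ (univ : Set S1))
    ((isCompact_closedBall _ _).prod isCompact_univ) fun x hx => ?_
  refine indicator_of_notMem (fun h => hx ⟨Metric.ball_subset_closedBall h, mem_univ _⟩) _

theorem le_gaussPair_cutPower {β r : ℝ} (hβ0 : 0 ≤ β) (hβ : β < 2) (hr : 0 < r) (hr1 : r ≤ 1) :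
    gaussConst * r ^ (-β) ≤ gaussPair r (cutPower β) := by
  refine le_gaussPair (integrable_cutPower hβ) (cutPower_nonneg β) hr ?_
  -- The origin must be discarded: for `β > 0`, `0 ^ (-β)` has the default value `0`, which violates
  -- the lower bound.
  have h0 : ∀ᵐ z : ℂ, z ≠ 0 := by
    simp [ae_iff, measure_singleton]
  filter_upwards [h0] with z hz hzr
  rw [mem_ball_zero_iff] at hzr
  rw [cutPower, indicator_of_mem (by simpa using hzr.trans_le hr1)]
  exact Real.rpow_le_rpow_of_nonpos (norm_pos_iff.2 hz) hzr.le (by linarith)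

theorem exists_lintegral_schattenNorm_fBeta_eq_top {q : ℝ} (hq1 : 1 < q) (hq2 : q < 2) :
    ∃ β : ℝ, 2 / 3 < β ∧ β < 1 ∧ ∫⁻ a in Ioi (0 : ℝ),
      schattenNorm basisH q (groupFourier (fBeta β) a) ^ q * ENNReal.ofReal a = ∞ := by
  obtain ⟨p, hpq⟩ : ∃ p : ℝ, p.HolderConjugate q :=
    ⟨_, (Real.HolderConjugate.conjExponent hq1).symm⟩
  have hp0 : 0 < p := hpq.pos
  have hq0 : 0 < q := by linarith
  have hp2 : 2 / p < 1 := by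
    have h1 := hpq.inv_add_inv_eq_one
    have h2 : (1 / 2 : ℝ) < q⁻¹ := by
      rw [one_div]
      exact inv_strictAnti₀ hq0 hq2
    rw [div_eq_mul_inv]
    linarith
  -- As `q < 2`, the conjugate exponent satisfies `2/p < 1`, leaving room for `2/p < s < β < 1`.
  obtain ⟨s, hs1, hs2⟩ := exists_between hp2
  have hs0 : 0 < s := lt_trans (by positivity) hs1
  obtain ⟨β, hβ1, hβ2⟩ := exists_between (max_lt hs2 (by norm_num : (2 / 3 : ℝ) < 1))
  rw [max_lt_iff] at hβ1
  refine ⟨β, hβ1.2, hβ2, ?_⟩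
  rw [← lintegral_plancherel]
  by_contra hfin
  have hf : Integrable fun z => (cutPower β z : ℂ) :=
    (integrable_cutPower (by linarith)).ofReal
  set D := ∫⁻ a, ENNReal.ofReal ‖radialFourier (fun z => cutPower β z) a‖ ^ q ∂plancherel with hD
  have hDfin : D ≠ ∞ := by
    refine ne_top_of_le_ne_top hfin (lintegral_mono fun a => ?_)
    refine ENNReal.rpow_le_rpow ?_ hq0.le
    rw [fBeta_eq]
    exact schattenNorm_groupFourier_comp_fst hf hq0 a
  set I := ∫⁻ a, ENNReal.ofReal ((1 + a ^ 2) ^ (-s / 2)) ^ p ∂plancherel with hI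
  have hIfin : I ≠ ∞ := lintegral_japanese_rpow_ne_top hp0 (by rwa [div_lt_iff₀ hp0] at hs1)
  have hIp : I ^ (1 / p) ≠ ∞ := ENNReal.rpow_ne_top_of_nonneg (by positivity) hIfin
  have hDq : D ^ (1 / q) ≠ ∞ := ENNReal.rpow_ne_top_of_nonneg (by positivity) hDfin
  -- Hölder bounds the Gaussian pairing by `r^{-s}` times a fixed finite constant, against its lower
  -- bound of order `r^{-β}`.
  refine not_forall_rpow_le hβ1.1 gaussConst_pos
    (M := (I ^ (1 / p) * D ^ (1 / q)).toReal) fun N => ?_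
  set r : ℝ := (1 / 2 : ℝ) ^ (N + 1) with hr_def
  have hr : 0 < r := by positivity
  have hr1 : r ≤ 1 := pow_le_one₀ (by norm_num) (by norm_num)
  refine (le_gaussPair_cutPower (by linarith) (by linarith) hr hr1).trans ?_
  have h1 := integral_gaussian_mul_radialFourier_ofReal (integrable_cutPower (β := β)
    (by linarith)) hr
  have h2 : ENNReal.ofReal (gaussPair r (cutPower β))
      ≤ ENNReal.ofReal (r ^ (-s)) * (I ^ (1 / p) * D ^ (1 / q)) := by
    calc ENNReal.ofReal (gaussPair r (cutPower β))
        = ‖∫ a, ((Real.exp (-r ^ 2 * a ^ 2) : ℝ) : ℂ) *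
            radialFourier (fun z => cutPower β z) a ∂plancherel‖ₑ := by
          rw [h1, ← ofReal_norm, Complex.norm_real,
            Real.norm_of_nonneg (gaussPair_nonneg (cutPower_nonneg β) r)]
      _ ≤ ∫⁻ a, ‖((Real.exp (-r ^ 2 * a ^ 2) : ℝ) : ℂ) *
            radialFourier (fun z => cutPower β z) a‖ₑ ∂plancherel :=
          enorm_integral_le_lintegral_enorm _
      _ ≤ ∫⁻ a, ENNReal.ofReal (r ^ (-s)) *
            (((fun a => ENNReal.ofReal ((1 + a ^ 2) ^ (-s / 2))) *
            fun a => ENNReal.ofReal ‖radialFourier (fun z => cutPower β z) a‖) a)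
              ∂plancherel := by
          refine lintegral_mono fun a => ?_
          simp only [Pi.mul_apply]
          rw [enorm_mul, ← mul_assoc, ← ENNReal.ofReal_mul (by positivity), ofReal_norm]
          refine mul_le_mul_left ?_ _
          rw [← ofReal_norm, Complex.norm_real, Real.norm_eq_abs, Real.abs_exp]
          exact ENNReal.ofReal_le_ofReal
            (gaussian_le_japanese hr hr1 hs0.le (by linarith) a)
      _ ≤ _ := by
          rw [lintegral_const_mul' _ _ ENNReal.ofReal_ne_top]
          refine mul_le_mul_right (ENNReal.lintegral_mul_le_Lp_mul_Lq _ hpq (by fun_prop) ?_) _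
          exact (measurable_radialFourier hf).norm.aemeasurable.ennreal_ofReal
  have h3 := ENNReal.toReal_mono (ENNReal.mul_ne_top ENNReal.ofReal_ne_top
    (ENNReal.mul_ne_top hIp hDq)) h2
  rw [ENNReal.toReal_ofReal (gaussPair_nonneg (cutPower_nonneg β) r), ENNReal.toReal_mul,
    ENNReal.toReal_ofReal (by positivity)] at h3
  linarith

/-! ### Smooth functions -/

theorem phase_eq_fourierChar (a : ℝ) (z : ℂ) (θ : S1) :
    phase a z θ = Real.fourierChar (-inner ℝ z (-((a / (2 * Real.pi) : ℝ) : ℂ) * ei θ)) := by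
  have hconj : ei (-θ) = (starRingEnd ℂ) (ei θ) := by
    rw [ei, AddCircle.toCircle_neg, Circle.coe_inv_eq_conj, ei]
  rw [Real.fourierChar_apply, phase, ContinuousMap.coe_mk, mul_comm Complex.I]
  congr 3
  rw [hconj, Complex.inner]
  simp only [Complex.mul_re, Complex.mul_im, Complex.neg_re, Complex.neg_im, Complex.ofReal_re,
    Complex.ofReal_im, Complex.conj_re, Complex.conj_im]
  field_simp
  ring

/-- The integral is the Fourier transform of a Schwartz function at a point of modulus `|a|/(2π)`,
whence a bound uniform in `θ`. Fourth order decay suffices for integrability against `a da`. -/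
theorem exists_norm_integral_mul_phase_le {f : ℂ → ℂ} (hf : ContDiff ℝ (⊤ : ℕ∞) f)
    (hc : HasCompactSupport f) : ∃ C : ℝ, ∀ (a : ℝ) (θ : S1),
      ‖∫ z, f z * phase a z θ‖ ≤ C * (1 + a ^ 2) ^ (-(4 : ℝ) / 2) := by
  set g := FourierTransform.fourier (hc.toSchwartzMap hf) with hg
  obtain ⟨C₀, -, h0⟩ := g.decay 0 0
  obtain ⟨C₄, -, h4⟩ := g.decay 4 0
  simp only [norm_iteratedFDeriv_zero, pow_zero, one_mul] at h0 h4
  -- The constant comes from `(1 + a²)² ≤ 2 + 2a⁴`, with the bounds of order `0` and `4` for the two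
  -- terms.
  refine ⟨2 * C₀ + 2 * ((2 * Real.pi) ^ 4 * C₄), fun a θ => ?_⟩
  set w : ℂ := -((a / (2 * Real.pi) : ℝ) : ℂ) * ei θ with hw
  have hgw : g w = ∫ z, f z * phase a z θ := by
    rw [hg, SchwartzMap.fourier_coe, Real.fourier_eq]
    refine integral_congr_ae (Filter.Eventually.of_forall fun z => ?_)
    simp only [phase_eq_fourierChar, Circle.smul_def, smul_eq_mul]
    rw [mul_comm]
    rfl
  have hwn : ‖w‖ ^ 4 = a ^ 4 / (2 * Real.pi) ^ 4 := by
    rw [hw, norm_mul, norm_neg, norm_ei, mul_one, Complex.norm_real, Real.norm_eq_abs,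
      Even.pow_abs (by decide), div_pow]
  have h0' := h0 w
  have h4' := h4 w
  rw [hwn, hgw] at h4'
  rw [hgw] at h0'
  have h5 : a ^ 4 * ‖∫ z, f z * phase a z θ‖ ≤ (2 * Real.pi) ^ 4 * C₄ := by
    rw [div_mul_eq_mul_div, div_le_iff₀ (by positivity)] at h4'
    linarith
  have h6 : (1 + a ^ 2) ^ (-(4 : ℝ) / 2) = ((1 + a ^ 2) ^ 2)⁻¹ := by
    rw [show (-(4 : ℝ) / 2) = -((2 : ℕ) : ℝ) by norm_num, Real.rpow_neg (by positivity),
      Real.rpow_natCast]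
  rw [h6, ← div_eq_mul_inv, le_div_iff₀ (by positivity)]
  have h7 : (1 + a ^ 2) ^ 2 ≤ 2 + 2 * a ^ 4 := by nlinarith [sq_nonneg (a ^ 2 - 1)]
  calc ‖∫ z, f z * phase a z θ‖ * (1 + a ^ 2) ^ 2
      ≤ ‖∫ z, f z * phase a z θ‖ * (2 + 2 * a ^ 4) :=
        mul_le_mul_of_nonneg_left h7 (norm_nonneg _)
    _ ≤ _ := by linarith

theorem integral_mul_phaseMean {f : ℂ → ℂ} (hf : Integrable f) (a : ℝ) :
    ∫ z, f z * phaseMean a z = ∫ θ, (∫ z, f z * phase a z θ) ∂AddCircle.haarAddCircle := by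
  have hphase : Continuous fun y : ℂ × S1 => phase a y.1 y.2 := by
    have hei : Continuous fun y : ℂ × S1 => ei (-y.2) :=
      continuous_ei.comp (continuous_neg.comp continuous_snd)
    simp only [phase, ContinuousMap.coe_mk]
    fun_prop
  have hfst : Integrable (fun y : ℂ × S1 => f y.1) (volume.prod AddCircle.haarAddCircle) :=
    hf.comp_fst _
  have hint : Integrable (fun y : ℂ × S1 => f y.1 * phase a y.1 y.2)
      (volume.prod AddCircle.haarAddCircle) :=
    hfst.mul_bdd (c := 1) hphase.aestronglyMeasurable
      (Filter.Eventually.of_forall fun y => (norm_phase a y.1 y.2).le)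
  rw [← integral_integral_swap (f := fun z θ => f z * phase a z θ) hint]
  simp only [phaseMean, integral_const_mul]

theorem integrable_radialFourier {f : ℂ → ℂ} (hf : ContDiff ℝ (⊤ : ℕ∞) f)
    (hc : HasCompactSupport f) : Integrable (radialFourier f) plancherel := by
  have hfi : Integrable f := hf.continuous.integrable_of_hasCompactSupport hc
  obtain ⟨C, hC⟩ := exists_norm_integral_mul_phase_le hf hc
  have hle : ∀ a, ‖radialFourier f a‖ ≤ 2 * Real.pi * C * (1 + a ^ 2) ^ (-(4 : ℝ) / 2) := by
    intro a
    have h2 : ‖∫ z, f z * phaseMean a z‖ ≤ C * (1 + a ^ 2) ^ (-(4 : ℝ) / 2) := by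
      rw [integral_mul_phaseMean hfi]
      refine (norm_integral_le_of_norm_le_const
        (Filter.Eventually.of_forall fun θ => hC a θ)).trans (le_of_eq ?_)
      rw [probReal_univ, mul_one]
    have h3 : ‖(2 * Real.pi : ℂ)‖ = 2 * Real.pi := by
      rw [norm_mul, Complex.norm_real, Real.norm_of_nonneg Real.pi_pos.le, Complex.norm_ofNat]
    rw [radialFourier_eq hfi, norm_mul, mul_assoc (2 * Real.pi), h3]
    exact mul_le_mul_of_nonneg_left h2 Real.two_pi_pos.le
  have hj := (integrable_japanese_plancherel (r := 4) (by norm_num)).const_mul (2 * Real.pi * C)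
  exact hj.mono' (measurable_radialFourier hfi) (Filter.Eventually.of_forall hle)

/-! ### Concentrating bumps -/

/-- A smooth bump of height `1 / r` on the disc of radius `r`, supported in the disc of radius
`√2 r`. -/
def bump (r : ℝ) (z : ℂ) : ℝ := r⁻¹ * Real.smoothTransition (2 - ‖z‖ ^ 2 / r ^ 2)

theorem bump_nonneg {r : ℝ} (hr : 0 < r) (z : ℂ) : 0 ≤ bump r z :=
  mul_nonneg (by positivity) (Real.smoothTransition.nonneg _)

theorem bump_eq_zero {r : ℝ} (hr : 0 < r) {z : ℂ} (hz : 2 * r ≤ ‖z‖) : bump r z = 0 := by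
  rw [bump, Real.smoothTransition.zero_of_nonpos, mul_zero]
  rw [sub_nonpos, le_div_iff₀ (by positivity)]
  nlinarith

theorem inv_le_bump {r : ℝ} (hr : 0 < r) {z : ℂ} (hz : z ∈ Metric.ball (0 : ℂ) r) :
    r⁻¹ ≤ bump r z := by
  rw [mem_ball_zero_iff] at hz
  rw [bump, Real.smoothTransition.one_of_one_le, mul_one]
  have : ‖z‖ ^ 2 / r ^ 2 ≤ 1 := by
    rw [div_le_one (by positivity)]
    exact pow_le_pow_left₀ (norm_nonneg _) hz.le 2
  linarith

theorem bump_le {r : ℝ} (hr : 0 < r) (z : ℂ) : bump r z ≤ r⁻¹ := by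
  have := mul_le_mul_of_nonneg_left (Real.smoothTransition.le_one (2 - ‖z‖ ^ 2 / r ^ 2))
    (inv_nonneg.2 hr.le)
  rwa [mul_one] at this

theorem contDiff_bump (r : ℝ) : ContDiff ℝ (⊤ : ℕ∞) (fun z => (bump r z : ℂ)) := by
  have h1 : ContDiff ℝ (⊤ : ℕ∞) (bump r) :=
    contDiff_const.mul (Real.smoothTransition.contDiff.comp
      (contDiff_const.sub ((contDiff_norm_sq ℝ).div_const _)))
  exact Complex.ofRealCLM.contDiff.comp h1

theorem hasCompactSupport_bump {r : ℝ} (hr : 0 < r) :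
    HasCompactSupport (fun z => (bump r z : ℂ)) := by
  refine HasCompactSupport.intro (isCompact_closedBall (0 : ℂ) (2 * r)) fun z hz => ?_
  rw [mem_closedBall_zero_iff, not_le] at hz
  rw [bump_eq_zero hr hz.le, Complex.ofReal_zero]

theorem integrable_ofReal_bump {r : ℝ} (hr : 0 < r) : Integrable (fun z => (bump r z : ℂ)) :=
  (contDiff_bump r).continuous.integrable_of_hasCompactSupport (hasCompactSupport_bump hr)

theorem integrable_bump {r : ℝ} (hr : 0 < r) : Integrable (bump r) := by
  simpa using (integrable_ofReal_bump hr).re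

theorem le_gaussPair_bump {r : ℝ} (hr : 0 < r) : gaussConst * r⁻¹ ≤ gaussPair r (bump r) :=
  le_gaussPair (integrable_bump hr) (bump_nonneg hr) hr
    (Filter.Eventually.of_forall fun _ hz => inv_le_bump hr hz)

/-- Height `1/r` on a set of measure `π(2r)² · 2π = 8π²r²` gives at most `√8 π < 3π`, whatever `r`
is. -/
theorem eLpNorm_bump_le {r : ℝ} (hr : 0 < r) :
    eLpNorm (fun x : M2 => (bump r x.1 : ℂ)) 2 haar ≤ ENNReal.ofReal (3 * Real.pi) := by
  set s : Set M2 := Metric.ball (0 : ℂ) (2 * r) ×ˢ univ with hs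
  have hsm : MeasurableSet s := Metric.isOpen_ball.measurableSet.prod MeasurableSet.univ
  have h1 : eLpNorm (fun x : M2 => (bump r x.1 : ℂ)) 2 haar
      ≤ eLpNorm (s.indicator fun _ => r⁻¹) 2 haar := by
    refine eLpNorm_mono fun x => ?_
    rw [Complex.norm_real, Real.norm_of_nonneg (bump_nonneg hr _)]
    by_cases hx : x ∈ s
    · rw [indicator_of_mem hx, Real.norm_of_nonneg (by positivity)]
      exact bump_le hr _
    · rw [indicator_of_notMem hx, norm_zero, bump_eq_zero hr]
      by_contra h
      exact hx ⟨by simpa using h, mem_univ _⟩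
  refine h1.trans ?_
  have h2 : haar s = ENNReal.ofReal (8 * Real.pi ^ 2 * r ^ 2) := by
    rw [hs, Measure.prod_prod, Complex.volume_ball, AddCircle.measure_univ,
      ← ENNReal.ofReal_pow (by positivity), ← NNReal.coe_real_pi, ← ENNReal.ofReal_coe_nnreal,
      ← ENNReal.ofReal_mul (by positivity), ← ENNReal.ofReal_mul (by positivity)]
    congr 1
    ring
  rw [eLpNorm_indicator_const hsm two_ne_zero ENNReal.ofNat_ne_top, h2, ← ofReal_norm,
    Real.norm_of_nonneg (by positivity), ENNReal.ofReal_rpow_of_nonneg (by positivity)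
    (by positivity), ← ENNReal.ofReal_mul (by positivity)]
  refine ENNReal.ofReal_le_ofReal ?_
  rw [ENNReal.toReal_ofNat, ← Real.sqrt_eq_rpow, inv_mul_le_iff₀ hr]
  refine Real.sqrt_le_iff.2 ⟨by positivity, ?_⟩
  nlinarith [mul_pos Real.pi_pos hr]

theorem memLp_bump {r : ℝ} (hr : 0 < r) : MemLp (fun x : M2 => (bump r x.1 : ℂ)) 2 haar :=
  ⟨((contDiff_bump r).continuous.comp continuous_fst).aestronglyMeasurable,
    (eLpNorm_bump_le hr).trans_lt ENNReal.ofReal_lt_top⟩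

theorem norm_toLp_bump_le {r : ℝ} (hr : 0 < r) : ‖(memLp_bump hr).toLp‖ ≤ 3 * Real.pi := by
  rw [Lp.norm_toLp]
  exact ENNReal.toReal_le_of_le_ofReal (by positivity) (eLpNorm_bump_le hr)

theorem memLp_discTwo :
    MemLp (fun x : M2 => (Metric.ball (0 : ℂ) 2).indicator (1 : ℂ → ℂ) x.1) 2 haar := by
  have h : MemLp ((Metric.ball (0 : ℂ) 2 ×ˢ (univ : Set S1)).indicator fun _ => (1 : ℂ)) 2 haar :=
    memLp_indicator_const 2 (Metric.isOpen_ball.measurableSet.prod MeasurableSet.univ) 1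
      (Or.inr (by
        rw [Measure.prod_prod]
        exact ENNReal.mul_ne_top measure_ball_lt_top.ne (measure_ne_top _ _)))
  refine h.ae_eq (Filter.Eventually.of_forall fun x => ?_)
  simp [indicator]

/-- The characteristic function of the set of all `(z, φ)` with `|z| < 2`, in `L²(M(2))`. -/
def discTwo : Lp ℂ 2 haar := memLp_discTwo.toLp

theorem discTwo_coeFn :
    discTwo =ᵐ[haar] fun x : M2 => (Metric.ball (0 : ℂ) 2).indicator 1 x.1 :=
  memLp_discTwo.coeFn_toLp

/-! ### Unboundedness of the Weyl transform -/

theorem pairing_gaussian_bump {r t : ℝ} (hr : 0 < r) (hr2 : 2 * r ≤ 1) (ht : 0 < t) :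
    pairing (diskSymbol fun a => Real.exp (-t ^ 2 * a ^ 2)) (memLp_bump hr).toLp discTwo
      = ((2 * Real.pi ^ 2 * gaussPair t (bump r) : ℝ) : ℂ) := by
  rw [pairing_diskSymbol (integrable_ofReal_bump hr)
    (fun z hz => by rw [bump_eq_zero hr (hr2.trans hz), Complex.ofReal_zero])
    (memLp_bump hr).coeFn_toLp discTwo_coeFn,
    integral_gaussian_mul_radialFourier_ofReal (integrable_bump hr) ht]
  push_cast
  rfl

theorem half_pow_props (N : ℕ) : 0 < (1 / 2 : ℝ) ^ (N + 1) ∧ (1 / 2 : ℝ) ^ (N + 1) ≤ 1 ∧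
    2 * (1 / 2 : ℝ) ^ (N + 1) ≤ 1 := by
  have h : (1 / 2 : ℝ) ^ N ≤ 1 := pow_le_one₀ (by norm_num) (by norm_num)
  refine ⟨by positivity, pow_le_one₀ (by norm_num) (by norm_num), ?_⟩
  rw [pow_succ]
  linarith

theorem not_exists_pairing_bound {p : ℝ} (hp : 2 < p) :
    ¬ ∃ C : ℝ, ∀ ς : M2 → ℝ → H →L[ℂ] H, MemSymbol 2 ς → MemSymbol p ς →
        ∀ f g : Lp ℂ 2 haar,
          ‖pairing ς f g‖ ≤ C * (symbolNorm p ς).toReal * ‖f‖ * ‖g‖ := by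
  rintro ⟨C, hC⟩
  have hp0 : 0 < p := by linarith
  obtain ⟨s, hs1, hs2⟩ := exists_between ((div_lt_one hp0).2 hp)
  have hs0 : 0 < s := lt_trans (by positivity) hs1
  have hsp : 2 < s * p := by rwa [div_lt_iff₀ hp0] at hs1
  obtain ⟨M, hM0, hM⟩ := exists_symbolNorm_diskSymbol_le hp0 hsp
  -- Here the larger exponent is `1`, from the height `r⁻¹` of the bump.
  refine not_forall_rpow_le hs2 (c := 2 * Real.pi ^ 2 * gaussConst)
    (mul_pos (by positivity) gaussConst_pos)
    (M := |C| * M * (3 * Real.pi) * ‖discTwo‖) fun N => ?_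
  obtain ⟨hr, hr1, hr2⟩ := half_pow_props N
  set r : ℝ := (1 / 2 : ℝ) ^ (N + 1)
  have hm : Measurable fun a : ℝ => Real.exp (-r ^ 2 * a ^ 2) := by fun_prop
  have hb : ∀ s : ℝ, 0 ≤ s → s ≤ 2 → ∀ a : ℝ,
      |Real.exp (-r ^ 2 * a ^ 2)| ≤ r ^ (-s) * (1 + a ^ 2) ^ (-s / 2) := by
    intro s hs0 hs2 a
    rw [Real.abs_exp]
    exact gaussian_le_japanese hr hr1 hs0 hs2 a
  have h1 := hC (diskSymbol fun a => Real.exp (-r ^ 2 * a ^ 2))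
    (memSymbol_diskSymbol (s := 2) two_pos (by norm_num) hm (by positivity)
      (hb 2 two_pos.le le_rfl))
    (memSymbol_diskSymbol hp0 hsp hm (by positivity) (hb s hs0.le (by linarith)))
    (memLp_bump hr).toLp discTwo
  rw [pairing_gaussian_bump hr hr2 hr, Complex.norm_real, Real.norm_of_nonneg
    (mul_nonneg (by positivity) (gaussPair_nonneg (bump_nonneg hr) r))] at h1
  have h2 : (symbolNorm p (diskSymbol fun a => Real.exp (-r ^ 2 * a ^ 2))).toReal
      ≤ r ^ (-s) * M :=
    ENNReal.toReal_le_of_le_ofReal (by positivity)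
      (hM _ _ (by positivity) (hb s hs0.le (by linarith)))
  calc 2 * Real.pi ^ 2 * gaussConst * r ^ (-1 : ℝ)
      = 2 * Real.pi ^ 2 * (gaussConst * r⁻¹) := by rw [Real.rpow_neg_one]; ring
    _ ≤ 2 * Real.pi ^ 2 * gaussPair r (bump r) :=
        mul_le_mul_of_nonneg_left (le_gaussPair_bump hr) (by positivity)
    _ ≤ _ := h1
    _ ≤ |C| * (r ^ (-s) * M) * (3 * Real.pi) * ‖discTwo‖ := by
        gcongr
        · exact le_abs_self C
        · exact norm_toLp_bump_le hr
    _ = _ := by ring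

theorem norm_integral_mul_discTwo_le (u : Lp ℂ 2 haar) :
    ‖∫ x, u x * discTwo x ∂haar‖ ≤ ‖u‖ * ‖discTwo‖ := by
  have h : ∫ x, u x * discTwo x ∂haar = inner ℂ discTwo u := by
    rw [L2.inner_def]
    refine integral_congr_ae ?_
    filter_upwards [discTwo_coeFn] with x hx
    rw [hx, RCLike.inner_apply]
    by_cases hx : x.1 ∈ Metric.ball (0 : ℂ) 2
    · simp [indicator_of_mem hx]
    · simp [indicator_of_notMem hx]
  rw [h]
  exact (norm_inner_le_norm _ _).trans (le_of_eq (mul_comm _ _))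

/-- The superposition `∑ 2^{-kγ} e^{-4^{-k} a²}` of Gaussians. -/
def gaussSum (γ a : ℝ) : ℝ :=
  ∑' k : ℕ, ((1 / 2 : ℝ) ^ k) ^ γ * Real.exp (-((1 / 2 : ℝ) ^ k) ^ 2 * a ^ 2)

theorem summable_half_pow_rpow {γ : ℝ} (hγ : 0 < γ) :
    Summable fun k : ℕ => ((1 / 2 : ℝ) ^ k) ^ γ := by
  have h : ∀ k : ℕ, ((1 / 2 : ℝ) ^ k) ^ γ = ((1 / 2 : ℝ) ^ γ) ^ k := by
    intro k
    rw [← Real.rpow_natCast, ← Real.rpow_natCast, ← Real.rpow_mul (by norm_num),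
      ← Real.rpow_mul (by norm_num), mul_comm]
  simp only [h]
  exact summable_geometric_of_lt_one (by positivity) (Real.rpow_lt_one (by norm_num)
    (by norm_num) hγ)

theorem gaussSum_term_le (γ a : ℝ) (k : ℕ) :
    ‖((1 / 2 : ℝ) ^ k) ^ γ * Real.exp (-((1 / 2 : ℝ) ^ k) ^ 2 * a ^ 2)‖
      ≤ ((1 / 2 : ℝ) ^ k) ^ γ := by
  rw [Real.norm_of_nonneg (by positivity)]
  refine mul_le_of_le_one_right (by positivity) (Real.exp_le_one_iff.2 ?_)
  rw [neg_mul, neg_nonpos]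
  positivity

theorem continuous_gaussSum {γ : ℝ} (hγ : 0 < γ) : Continuous (gaussSum γ) :=
  continuous_tsum (fun k => by fun_prop) (summable_half_pow_rpow hγ)
    fun k a => gaussSum_term_le γ a k

/-- Each Gaussian costs `2^{ks}`, so the weights `2^{-kγ}` leave a convergent geometric series
because `s < γ`. -/
theorem abs_gaussSum_le {γ s : ℝ} (hs0 : 0 ≤ s) (hs2 : s ≤ 2) (hγ : s < γ) (a : ℝ) :
    |gaussSum γ a| ≤ (∑' k : ℕ, ((1 / 2 : ℝ) ^ k) ^ (γ - s)) * (1 + a ^ 2) ^ (-s / 2) := by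
  rw [gaussSum, abs_of_nonneg (tsum_nonneg fun k => by positivity), ← tsum_mul_right]
  refine Summable.tsum_le_tsum (fun k => ?_)
    (Summable.of_norm_bounded (summable_half_pow_rpow (by linarith))
      (gaussSum_term_le γ a)) ((summable_half_pow_rpow (by linarith)).mul_right _)
  have hk : (0 : ℝ) < (1 / 2 : ℝ) ^ k := by positivity
  calc ((1 / 2 : ℝ) ^ k) ^ γ * Real.exp (-((1 / 2 : ℝ) ^ k) ^ 2 * a ^ 2)
      ≤ ((1 / 2 : ℝ) ^ k) ^ γ * (((1 / 2 : ℝ) ^ k) ^ (-s) * (1 + a ^ 2) ^ (-s / 2)) :=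
        mul_le_mul_of_nonneg_left (gaussian_le_japanese hk
          (pow_le_one₀ (by norm_num) (by norm_num)) hs0 hs2 a) (by positivity)
    _ = _ := by rw [← mul_assoc, ← Real.rpow_add hk, sub_eq_add_neg]

/-- Sum and integral are exchanged by domination with `2^{-kγ} |radialFourier|`; this is where
integrability of the transform, hence smoothness of the bumps, is needed. -/
theorem hasSum_gaussSum_mul_radialFourier {γ : ℝ} (hγ : 0 < γ) {φ : ℂ → ℝ}
    (hφ : Integrable φ) (hF : Integrable (radialFourier fun z => φ z) plancherel) :
    HasSum (fun k : ℕ => ((((1 / 2 : ℝ) ^ k) ^ γ * gaussPair ((1 / 2 : ℝ) ^ k) φ : ℝ) : ℂ))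
      (∫ a, (gaussSum γ a : ℂ) * radialFourier (fun z => φ z) a ∂plancherel) := by
  have hle : ∀ (k : ℕ) (a : ℝ),
      ‖((((1 / 2 : ℝ) ^ k) ^ γ * Real.exp (-((1 / 2 : ℝ) ^ k) ^ 2 * a ^ 2) : ℝ) : ℂ)‖
        ≤ ((1 / 2 : ℝ) ^ k) ^ γ := fun k a => by
    rw [Complex.norm_real]
    exact gaussSum_term_le γ a k
  have hint : ∀ k : ℕ, Integrable (fun a : ℝ =>
      ((((1 / 2 : ℝ) ^ k) ^ γ * Real.exp (-((1 / 2 : ℝ) ^ k) ^ 2 * a ^ 2) : ℝ) : ℂ)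
        * radialFourier (fun z => φ z) a) plancherel := fun k =>
    hF.bdd_mul (Continuous.aestronglyMeasurable (by fun_prop))
      (Filter.Eventually.of_forall (hle k))
  have hsum : Summable fun k : ℕ => ∫ a : ℝ,
      ‖((((1 / 2 : ℝ) ^ k) ^ γ * Real.exp (-((1 / 2 : ℝ) ^ k) ^ 2 * a ^ 2) : ℝ) : ℂ)
        * radialFourier (fun z => φ z) a‖ ∂plancherel := by
    refine Summable.of_nonneg_of_le (fun k => integral_nonneg fun a => norm_nonneg _)
      (fun k => ?_) ((summable_half_pow_rpow hγ).mul_right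
        (∫ a, ‖radialFourier (fun z => φ z) a‖ ∂plancherel))
    rw [← integral_const_mul]
    refine integral_mono (hint k).norm (hF.norm.const_mul _) fun a => ?_
    simp only [norm_mul _ (radialFourier _ _)]
    exact mul_le_mul_of_nonneg_right (hle k a) (norm_nonneg _)
  have h := hasSum_integral_of_summable_integral_norm hint hsum
  have h1 : ∀ a : ℝ, ∑' k : ℕ,
      ((((1 / 2 : ℝ) ^ k) ^ γ * Real.exp (-((1 / 2 : ℝ) ^ k) ^ 2 * a ^ 2) : ℝ) : ℂ)
        * radialFourier (fun z => φ z) a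
      = (gaussSum γ a : ℂ) * radialFourier (fun z => φ z) a := fun a => by
    rw [tsum_mul_right, gaussSum, Complex.ofReal_tsum]
  simp only [h1] at h
  have hk : ∀ k : ℕ, ((((1 / 2 : ℝ) ^ k) ^ γ * gaussPair ((1 / 2 : ℝ) ^ k) φ : ℝ) : ℂ)
      = ∫ a : ℝ, ((((1 / 2 : ℝ) ^ k) ^ γ * Real.exp (-((1 / 2 : ℝ) ^ k) ^ 2 * a ^ 2) : ℝ) : ℂ)
        * radialFourier (fun z => φ z) a ∂plancherel := fun k => by
    rw [Complex.ofReal_mul, ← integral_gaussian_mul_radialFourier_ofReal hφ (by positivity),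
      ← integral_const_mul]
    simp only [Complex.ofReal_mul, mul_assoc]
  simp only [hk]
  exact h

theorem exists_symbol_not_isWeylTransform {p : ℝ} (hp : 2 < p) :
    ∃ ς : M2 → ℝ → H →L[ℂ] H, MemSymbol p ς ∧
      ¬ ∃ W : Lp ℂ 2 haar →L[ℂ] Lp ℂ 2 haar, IsWeylTransform ς W := by
  have hp0 : 0 < p := by linarith
  obtain ⟨s, hs1, hs2⟩ := exists_between ((div_lt_one hp0).2 hp)
  have hs0 : 0 < s := lt_trans (by positivity) hs1
  have hsp : 2 < s * p := by rwa [div_lt_iff₀ hp0] at hs1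
  obtain ⟨γ, hγ1, hγ2⟩ := exists_between hs2
  have hγ0 : 0 < γ := hs0.trans hγ1
  refine ⟨diskSymbol (gaussSum γ), memSymbol_diskSymbol hp0 hsp
    (continuous_gaussSum hγ0).measurable (tsum_nonneg fun k => by positivity)
    (abs_gaussSum_le hs0.le (by linarith) hγ1), ?_⟩
  rintro ⟨W, hW⟩
  refine not_forall_rpow_le hγ2 (c := 2 * Real.pi ^ 2 * gaussConst)
    (mul_pos (by positivity) gaussConst_pos)
    (M := ‖W‖ * (3 * Real.pi) * ‖discTwo‖) fun N => ?_
  obtain ⟨hr, hr1, hr2⟩ := half_pow_props N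
  set r : ℝ := (1 / 2 : ℝ) ^ (N + 1) with hr_def
  have hF := integrable_radialFourier (contDiff_bump r) (hasCompactSupport_bump hr)
  have hsupp : ∀ z : ℂ, 1 ≤ ‖z‖ → (bump r z : ℂ) = 0 := fun z hz => by
    rw [bump_eq_zero hr (hr2.trans hz), Complex.ofReal_zero]
  have hconv : Integrable (fun a => (gaussSum γ a : ℂ) *
      radialFourier (fun z => bump r z) a) plancherel := by
    refine hF.bdd_mul (c := ∑' k : ℕ, ((1 / 2 : ℝ) ^ k) ^ γ)
      (Complex.continuous_ofReal.comp (continuous_gaussSum hγ0)).aestronglyMeasurable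
      (Filter.Eventually.of_forall fun a => ?_)
    rw [Complex.norm_real]
    exact tsum_of_norm_bounded (summable_half_pow_rpow hγ0).hasSum (gaussSum_term_le γ a)
  have h1 := hW (memLp_bump hr).toLp discTwo
    (pairingConverges_diskSymbol (integrable_ofReal_bump hr) hsupp (memLp_bump hr).coeFn_toLp
      discTwo_coeFn hconv)
  have hsum := hasSum_gaussSum_mul_radialFourier hγ0 (integrable_bump hr) hF
  rw [pairing_diskSymbol (integrable_ofReal_bump hr) hsupp (memLp_bump hr).coeFn_toLp
    discTwo_coeFn] at h1
  set J := ∫ a, (gaussSum γ a : ℂ) * radialFourier (fun z => bump r z) a ∂plancherel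
  -- All terms of the series are nonnegative; the term `k = N + 1` has exactly the scale `r` of the
  -- bump.
  have hJ : r ^ γ * gaussPair r (bump r) ≤ ‖J‖ := by
    have h2 := Complex.hasSum_re hsum
    simp only [Complex.ofReal_re] at h2
    have h3 := le_hasSum h2 (N + 1) fun k _ =>
      mul_nonneg (by positivity) (gaussPair_nonneg (bump_nonneg hr) _)
    exact h3.trans (Complex.re_le_norm J)
  have h4 : 2 * Real.pi ^ 2 * ‖J‖ ≤ ‖W‖ * (3 * Real.pi) * ‖discTwo‖ := by
    have h5 : ‖(2 * Real.pi ^ 2 : ℂ) * J‖ = 2 * Real.pi ^ 2 * ‖J‖ := by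
      rw [norm_mul, norm_mul, norm_pow, Complex.norm_real, Real.norm_of_nonneg Real.pi_pos.le]
      simp
    rw [← h5, ← h1]
    refine (norm_integral_mul_discTwo_le _).trans ?_
    refine mul_le_mul_of_nonneg_right ((W.le_opNorm _).trans ?_) (norm_nonneg _)
    exact mul_le_mul_of_nonneg_left (norm_toLp_bump_le hr) (norm_nonneg _)
  have hpow : 0 < r ^ γ := by positivity
  have h6 : 2 * Real.pi ^ 2 * (r ^ γ * (gaussConst * r⁻¹)) ≤
      ‖W‖ * (3 * Real.pi) * ‖discTwo‖ := by
    refine le_trans ?_ h4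
    refine mul_le_mul_of_nonneg_left (le_trans ?_ hJ) (by positivity)
    exact mul_le_mul_of_nonneg_left (le_gaussPair_bump hr) hpow.le
  rw [Real.rpow_neg_one, Real.rpow_neg hr.le, ← div_eq_mul_inv _ (r ^ γ), le_div_iff₀ hpow]
  linarith

end EuclideanMotion

end

theorem mainTheorem4 :
    (∀ β : ℝ, β < 1 → MemLp (fBeta β) 2 haar ∧ HasCompactSupport (fBeta β)) ∧
    (∀ q : ℝ, 1 < q → q < 2 → ∃ β : ℝ, 2 / 3 < β ∧ β < 1 ∧
      ∫⁻ a in Ioi (0 : ℝ),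
        schattenNorm basisH q (groupFourier (fBeta β) a) ^ q * ENNReal.ofReal a = ∞) ∧
    (∀ p : ℝ, 2 < p →
      (¬ ∃ C : ℝ, ∀ ς : M2 → ℝ → H →L[ℂ] H, MemSymbol 2 ς → MemSymbol p ς →
        ∀ f g : Lp ℂ 2 haar,
          ‖pairing ς f g‖ ≤ C * (symbolNorm p ς).toReal * ‖f‖ * ‖g‖) ∧
      ∃ ς : M2 → ℝ → H →L[ℂ] H, MemSymbol p ς ∧
        ¬ ∃ W : Lp ℂ 2 haar →L[ℂ] Lp ℂ 2 haar, IsWeylTransform ς W) := by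
  refine ⟨fun β hβ => ⟨memLp_fBeta hβ, hasCompactSupport_fBeta β⟩,
    fun q hq1 hq2 => exists_lintegral_schattenNorm_fBeta_eq_top hq1 hq2, fun p hp =>
    ⟨not_exists_pairing_bound hp, exists_symbol_not_isWeylTransform hp⟩⟩
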